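/- Let $n\in\mathbb{N}$, let $\Sigma,U_0,\Gamma\in\mathbb{S}_{++}^n$ (real symmetric positive definite $n\times n$ matrices) with $\Sigma U_0=U_0\Sigma$, and let $l\in\mathbb{R}^n$. Let $\pi$ be the Gaussian measure on $\mathbb{R}^n$ with density proportional to $\exp(-\tfrac12 q\cdot\Sigma^{-1}q)$, and let $f(q)=\tfrac12 q\cdot U_0q+l\cdot q$, $\pi(f)=\int f\,d\pi$. For each mass matrix $M\in\mathbb{S}_{++}^n$ let $$\tilde\pi_M(dq,dp)\propto\exp\Big(-\tfrac12 q\cdot\Sigma^{-1}q-\tfrac12 p\cdot M^{-1}p\Big)\,dq\,dp$$ be the invariant probability measure on $\mathbb{R}^{2n}$ of the underdamped Langevin dynamics with friction matrix $\Gamma$, and let $$\mathcal{L}_M=M^{-1}p\cdot\nabla_q-\Sigma^{-1}q\cdot\nabla_p-\Gamma M^{-1}p\cdot\nabla_p+\nabla_p\cdot\Gamma\nabla_p$$ be its generator, with formal $L^2(\tilde\pi_M)$-adjoint $$\mathcal{L}_M^*=-M^{-1}p\cdot\nabla_q+\Sigma^{-1}q\cdot\nabla_p-\Gamma M^{-1}p\cdot\nabla_p+\nabla_p\cdot\Gamma\nabla_p.$$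 A solution of the Poisson equation $-\mathcal{L}_M\phi=f-\pi(f)$ is a function $\phi\in L^2(\tilde\pi_M)$ with $\int\phi\,d\tilde\pi_M=0$ that satisfies it in the distributional sense, that is, $-\int\phi\,\mathcal{L}_M^*h\,d\tilde\pi_M=\int(f-\pi(f))\,h\,d\tilde\pi_M$ for all $h\in C_c^\infty(\mathbb{R}^{2n})$. Then for every $M\in\mathbb{S}_{++}^n$ a solution exists, and one can be chosen to be $C^\infty$ and to satisfy the equation pointwise. Moreover, if $\phi_M$ is a solution for each $M\in\mathbb{S}_{++}^n$, then the following limit exists in $\mathbb{R}$ and $$\lim_{m\to0^+}\int\phi_{mI_n}\,(f-\pi(f))\,d\tilde\pi_{mI_n}=\inf_{M\in\mathbb{S}_{++}^n}\int\phi_M\,(f-\pi(f))\,d\tilde\pi_M .$$ (Twice the integral $\int\phi_M(f-\pi(f))\,d\tilde\pi_M$ is the asymptotic variance for the observable $f$.) -/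

import Mathlib

open MeasureTheory Filter Topology Matrix
open scoped ContDiff

/-- Positions (or momenta) in coordinates, `ℝⁿ`. -/
abbrev Coord (n : ℕ) : Type := Fin n → ℝ

/-- Phase space `ℝ²ⁿ`; a point is `z = (q, p)`. -/
abbrev PhaseSpace (n : ℕ) : Type := Coord n × Coord n

noncomputable section

/-- The unnormalised centred Gaussian measure `exp (-x ⬝ S⁻¹ x / 2) dx` on `ℝⁿ`. -/
def gaussianWeight {n : ℕ} (S : Matrix (Fin n) (Fin n) ℝ) : Measure (Coord n) :=
  volume.withDensity fun x => ENNReal.ofReal (Real.exp (-(1 / 2) * (x ⬝ᵥ (S⁻¹ *ᵥ x))))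

/-- The centred Gaussian probability measure `∝ exp (-x ⬝ S⁻¹ x / 2) dx` on `ℝⁿ`,
for `S` positive definite. -/
def centredGaussian {n : ℕ} (S : Matrix (Fin n) (Fin n) ℝ) : Measure (Coord n) :=
  (gaussianWeight S Set.univ)⁻¹ • gaussianWeight S

/-- The invariant measure `∝ exp (-q ⬝ S⁻¹ q / 2 - p ⬝ M⁻¹ p / 2) dq dp` of the Langevin dynamics
with potential `U(q) = q ⬝ S⁻¹ q / 2` and mass matrix `M`. -/
def invariantMeasure {n : ℕ} (S M : Matrix (Fin n) (Fin n) ℝ) : Measure (PhaseSpace n) :=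
  (centredGaussian S).prod (centredGaussian M)

/-- The observable `f(q) = q ⬝ U₀ q / 2 + l ⬝ q`. -/
def quadObservable {n : ℕ} (U₀ : Matrix (Fin n) (Fin n) ℝ) (l : Coord n) (q : Coord n) : ℝ :=
  (1 / 2) * (q ⬝ᵥ (U₀ *ᵥ q)) + l ⬝ᵥ q

/-- The centred observable `f - π(f)`, where `π` is the centred Gaussian with covariance `S`. -/
def centredObservable {n : ℕ} (S U₀ : Matrix (Fin n) (Fin n) ℝ) (l : Coord n) (q : Coord n) : ℝ :=
  quadObservable U₀ l q - ∫ x, quadObservable U₀ l x ∂(centredGaussian S)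

/-- The directional derivative `v ⬝ ∇_q h` at `z`. -/
def derivQ {n : ℕ} (h : PhaseSpace n → ℝ) (z : PhaseSpace n) (v : Coord n) : ℝ :=
  fderiv ℝ h z (v, 0)

/-- The directional derivative `v ⬝ ∇_p h` at `z`. -/
def derivP {n : ℕ} (h : PhaseSpace n → ℝ) (z : PhaseSpace n) (v : Coord n) : ℝ :=
  fderiv ℝ h z (0, v)

/-- The second-order term `∇_p ⬝ Γ ∇_p h = ∑ᵢⱼ Γᵢⱼ ∂_{pᵢ} ∂_{pⱼ} h` at `z`. -/
def diffusionP {n : ℕ} (Γ : Matrix (Fin n) (Fin n) ℝ) (h : PhaseSpace n → ℝ)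
    (z : PhaseSpace n) : ℝ :=
  ∑ i, ∑ j, Γ i j * derivP (fun w => derivP h w (Pi.single j 1)) z (Pi.single i 1)

/-- The generator
`𝓛 h = M⁻¹p ⬝ ∇_q h - S⁻¹q ⬝ ∇_p h - Γ M⁻¹ p ⬝ ∇_p h + ∇_p ⬝ Γ ∇_p h`. -/
def generator {n : ℕ} (S Γ M : Matrix (Fin n) (Fin n) ℝ) (h : PhaseSpace n → ℝ)
    (z : PhaseSpace n) : ℝ :=
  derivQ h z (M⁻¹ *ᵥ z.2) - derivP h z (S⁻¹ *ᵥ z.1) - derivP h z (Γ *ᵥ (M⁻¹ *ᵥ z.2))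
    + diffusionP Γ h z

/-- The formal adjoint of the generator in `L²` of the invariant measure,
`𝓛* h = -M⁻¹p ⬝ ∇_q h + S⁻¹q ⬝ ∇_p h - Γ M⁻¹ p ⬝ ∇_p h + ∇_p ⬝ Γ ∇_p h`. -/
def adjointGenerator {n : ℕ} (S Γ M : Matrix (Fin n) (Fin n) ℝ) (h : PhaseSpace n → ℝ)
    (z : PhaseSpace n) : ℝ :=
  -derivQ h z (M⁻¹ *ᵥ z.2) + derivP h z (S⁻¹ *ᵥ z.1) - derivP h z (Γ *ᵥ (M⁻¹ *ᵥ z.2))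
    + diffusionP Γ h z

/-- `φ ∈ L²₀` of the invariant measure solves the Poisson equation `-𝓛 φ = f - π(f)` in the sense
of distributions (tested in `L²` of the invariant measure against smooth functions of compact
support). Solutions for the `L²` generator, and classical solutions in `L²₀`, are of this kind. -/
structure IsPoissonSolution {n : ℕ} (S Γ M U₀ : Matrix (Fin n) (Fin n) ℝ) (l : Coord n)
    (φ : PhaseSpace n → ℝ) : Prop where
  memLp : MemLp φ 2 (invariantMeasure S M)
  mean_zero : ∫ z, φ z ∂(invariantMeasure S M) = 0
  weak_eq : ∀ h : PhaseSpace n → ℝ, ContDiff ℝ ∞ h → HasCompactSupport h →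
    -∫ z, φ z * adjointGenerator S Γ M h z ∂(invariantMeasure S M)
      = ∫ z, centredObservable S U₀ l z.1 * h z ∂(invariantMeasure S M)

end

/-! For a quadratic observable and a quadratic potential the Poisson equation is solved by a
quadratic polynomial, with blocks a (qq), b (qp), c (pp). Comparing coefficients gives a linear
Lyapunov system (`IsLyapunovSolution`) with right-hand side W = S U₀ S, where S is the covariance.
The linear part l of the observable is handled explicitly and contributes the term Sl ⬝ ΓSl, which
does not depend on M. Half the asymptotic variance is therefore tr(aW)/2 + Sl ⬝ ΓSl
(`IsPoissonSolution.integral_mul_centredObservable`), and only tr(aW) has to be minimised.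

Write ⟨x, y⟩ = tr(Γ xᵀ S y), a positive definite inner product. The energy identity
`IsLyapunovSolution.trace_eq` reads tr(aW) = 2(|b|² + tr(Γ cᵀ M c)). With W = 0 it shows that the
Lyapunov operator is injective, hence surjective in finite dimension.

Every b arising in this way lies in the affine space bᵀS + Sb = W. Its element b₀ with b₀Γ symmetric
corresponds to the overdamped dynamics and is orthogonal to all differences b - b₀
(`trace_overdamped_eq`). Pythagoras then gives tr(aW) = tr(b₀ΓW) + 2(|b - b₀|² + tr(Γ cᵀ M c)), so
the overdamped value is a lower bound for every M. For M = mI the same excess also equals 2m tr(c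
b₀); comparing the two expressions bounds it by a multiple of m (`exists_trace_le_overdamped_add`).
So the limit m → 0 attains the lower bound.

An arbitrary weak solution φ is treated by duality, without a uniqueness theorem. Reversing the
momenta in the quadratic solution solves the adjoint equation, and testing the weak equation with
that polynomial computes the integral of φ against the observable. Since the polynomial has no
compact support, a cutoff argument (`IsPoissonSolution.weak_eq_of_hasTemperateGrowth`) comes first.
-/

/-! ### Integrability of functions of temperate growth against Gaussian weights -/

section GaussianIntegrability

variable {E : Type*} [NormedAddCommGroup E] [NormedSpace ℝ E]

theorem exists_pow_mul_exp_neg_mul_sq_le (k : ℕ) {c : ℝ} (hc : 0 < c) :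
    ∃ C : ℝ, ∀ r : ℝ, 0 ≤ r → (1 + r) ^ k * Real.exp (-(c * r ^ 2)) ≤ C := by
  have hb : ∀ r : ℝ, 0 ≤ r → (1 + r) ^ k * Real.exp (-(c * r ^ 2)) ≤
      Real.exp (k ^ 2 / (4 * c)) := by
    intro r hr
    have h1 : (1 + r) ^ k ≤ Real.exp (k * r) := by
      rw [Real.exp_nat_mul]
      gcongr
      linarith [Real.add_one_le_exp r]
    calc (1 + r) ^ k * Real.exp (-(c * r ^ 2))
        ≤ Real.exp (k * r) * Real.exp (-(c * r ^ 2)) := by gcongr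
      _ = Real.exp (k * r - c * r ^ 2) := by rw [← Real.exp_add]; ring_nf
      _ ≤ _ := by
        gcongr
        rw [le_div_iff₀ (by positivity)]
        -- Completing the square: k r - c r² is at most k² / (4c).
        nlinarith [sq_nonneg (k - 2 * c * r)]
  exact ⟨_, hb⟩

theorem Function.HasTemperateGrowth.exists_bound {F : E → ℝ} (hF : F.HasTemperateGrowth) :
    ∃ (k : ℕ) (C : ℝ), 0 ≤ C ∧ ∀ x, |F x| ≤ C * (1 + ‖x‖) ^ k := by
  obtain ⟨k, C, hC, h⟩ := hF.norm_iteratedFDeriv_le_uniform 0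
  exact ⟨k, C, hC, fun x => by simpa using h 0 le_rfl x⟩

theorem Function.HasTemperateGrowth.fderiv_apply {F : E → ℝ} (hF : F.HasTemperateGrowth) (v : E) :
    (fun x => fderiv ℝ F x v).HasTemperateGrowth := by
  have h : (fderiv ℝ F).HasTemperateGrowth := by
    refine ⟨hF.1.fderiv_right (by simp), fun n => ?_⟩
    obtain ⟨k, C, h⟩ := hF.2 (n + 1)
    exact ⟨k, C, fun x => by rw [norm_iteratedFDeriv_fderiv]; exact h x⟩
  exact (ContinuousLinearMap.apply ℝ ℝ v).hasTemperateGrowth.comp h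

/-- By homogeneity the minimum of Q over the compact unit sphere serves as the constant. -/
theorem exists_pos_mul_norm_sq_le [FiniteDimensional ℝ E] {Q : E → ℝ} (hQ : Continuous Q)
    (hpos : ∀ x, x ≠ 0 → 0 < Q x) (hhom : ∀ (t : ℝ) x, Q (t • x) = t ^ 2 * Q x) :
    ∃ c : ℝ, 0 < c ∧ ∀ x, c * ‖x‖ ^ 2 ≤ Q x := by
  have h0 : Q 0 = 0 := by simpa using hhom 0 0
  rcases subsingleton_or_nontrivial E with hE | hE
  · exact ⟨1, one_pos, fun x => by simp [Subsingleton.elim x 0, h0]⟩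
  obtain ⟨x₀, hx₀, hmin⟩ := (isCompact_sphere (0 : E) 1).exists_isMinOn
    (NormedSpace.sphere_nonempty.2 zero_le_one) hQ.continuousOn
  refine ⟨Q x₀, hpos _ (ne_zero_of_mem_unit_sphere ⟨x₀, hx₀⟩), fun x => ?_⟩
  rcases eq_or_ne x 0 with rfl | hx
  · simp [h0]
  have hm : Q x₀ ≤ Q (‖x‖⁻¹ • x) := hmin (by simp [norm_smul, hx])
  have hn : 0 < ‖x‖ := norm_pos_iff.2 hx
  rw [hhom] at hm
  calc Q x₀ * ‖x‖ ^ 2 ≤ (‖x‖⁻¹ ^ 2 * Q x) * ‖x‖ ^ 2 := by gcongr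
    _ = Q x := by field_simp

theorem Function.HasTemperateGrowth.integrable_mul_exp_neg [FiniteDimensional ℝ E]
    [MeasurableSpace E] [BorelSpace E] (μ : Measure E) [μ.IsAddHaarMeasure] {Q F : E → ℝ}
    (hQ : Continuous Q) {c : ℝ} (hc : 0 < c) (hcQ : ∀ x, c * ‖x‖ ^ 2 ≤ Q x)
    (hF : F.HasTemperateGrowth) : Integrable (fun x => F x * Real.exp (-Q x)) μ := by
  obtain ⟨k, C, hC, hb⟩ := hF.exists_bound
  obtain ⟨D, hD⟩ := exists_pow_mul_exp_neg_mul_sq_le (k + μ.integrablePower) hc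
  refine ((Measure.integrable_pow_neg_integrablePower μ).const_mul (C * D)).mono'
    (hF.1.continuous.mul (by fun_prop)).aestronglyMeasurable (Eventually.of_forall fun x => ?_)
  have h1 : (0 : ℝ) < 1 + ‖x‖ := by positivity
  rw [norm_mul, Real.norm_eq_abs, Real.norm_of_nonneg (Real.exp_pos _).le, Real.rpow_neg h1.le,
    Real.rpow_natCast, ← div_eq_mul_inv, le_div_iff₀ (by positivity)]
  calc |F x| * Real.exp (-Q x) * (1 + ‖x‖) ^ μ.integrablePower
      ≤ (C * (1 + ‖x‖) ^ k) * Real.exp (-(c * ‖x‖ ^ 2)) * (1 + ‖x‖) ^ μ.integrablePower := by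
        gcongr
        · exact hb x
        · exact hcQ x
    _ = C * ((1 + ‖x‖) ^ (k + μ.integrablePower) * Real.exp (-(c * ‖x‖ ^ 2))) := by
        rw [pow_add]; ring
    _ ≤ C * D := by gcongr; exact hD _ (norm_nonneg _)

end GaussianIntegrability

/-! ### The Gaussian measures and their common density exp(-H) -/

section Measures

variable {n : ℕ}

theorem Matrix.PosDef.dotProduct_mulVec_inv_pos {S : Matrix (Fin n) (Fin n) ℝ} (hS : S.PosDef)
    {x : Coord n} (hx : x ≠ 0) : 0 < x ⬝ᵥ (S⁻¹ *ᵥ x) := by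
  simpa using hS.inv.dotProduct_mulVec_pos hx

theorem gaussianWeight_univ_ne_zero (S : Matrix (Fin n) (Fin n) ℝ) :
    gaussianWeight S Set.univ ≠ 0 := by
  intro h
  rw [Measure.measure_univ_eq_zero, gaussianWeight, withDensity_eq_zero_iff (by fun_prop)] at h
  have h2 : ∀ᵐ x : Coord n, False := by
    filter_upwards [h] with x hx
    simp at hx
    exact absurd hx (not_le.2 (Real.exp_pos _))
  have h3 : (volume : Measure (Coord n)) = 0 := by simpa using h2
  exact NeZero.ne _ h3

theorem gaussianWeight_univ_ne_top {S : Matrix (Fin n) (Fin n) ℝ} (hS : S.PosDef) :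
    gaussianWeight S Set.univ ≠ ⊤ := by
  have hQ : Continuous fun x : Coord n => (1 / 2) * (x ⬝ᵥ (S⁻¹ *ᵥ x)) := by fun_prop
  obtain ⟨c, hc, hcQ⟩ := exists_pos_mul_norm_sq_le hQ
    (fun x hx => mul_pos one_half_pos (hS.dotProduct_mulVec_inv_pos hx))
    (fun t x => by simp [mulVec_smul]; ring)
  have hi := (Function.HasTemperateGrowth.const (E := Coord n) (1 : ℝ)).integrable_mul_exp_neg
    volume hQ hc hcQ
  rw [gaussianWeight, withDensity_apply _ .univ, Measure.restrict_univ]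
  have := hi.lintegral_lt_top.ne
  simpa [neg_mul] using this

theorem isProbabilityMeasure_centredGaussian {S : Matrix (Fin n) (Fin n) ℝ} (hS : S.PosDef) :
    IsProbabilityMeasure (centredGaussian S) :=
  ⟨by simp [centredGaussian, ENNReal.inv_mul_cancel (gaussianWeight_univ_ne_zero S)
    (gaussianWeight_univ_ne_top hS)]⟩

theorem isProbabilityMeasure_invariantMeasure {S M : Matrix (Fin n) (Fin n) ℝ} (hS : S.PosDef)
    (hM : M.PosDef) : IsProbabilityMeasure (invariantMeasure S M) := by
  have := isProbabilityMeasure_centredGaussian hS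
  have := isProbabilityMeasure_centredGaussian hM
  unfold invariantMeasure
  infer_instance

/-- The Hamiltonian `q ⬝ S⁻¹ q / 2 + p ⬝ M⁻¹ p / 2`. -/
noncomputable def hamiltonian (S M : Matrix (Fin n) (Fin n) ℝ) (z : PhaseSpace n) : ℝ :=
  (1 / 2) * (z.1 ⬝ᵥ (S⁻¹ *ᵥ z.1)) + (1 / 2) * (z.2 ⬝ᵥ (M⁻¹ *ᵥ z.2))

theorem continuous_hamiltonian (S M : Matrix (Fin n) (Fin n) ℝ) :
    Continuous (hamiltonian S M) := by
  unfold hamiltonian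
  fun_prop

theorem exists_mul_norm_sq_le_hamiltonian {S M : Matrix (Fin n) (Fin n) ℝ} (hS : S.PosDef)
    (hM : M.PosDef) : ∃ c : ℝ, 0 < c ∧ ∀ z, c * ‖z‖ ^ 2 ≤ hamiltonian S M z := by
  refine exists_pos_mul_norm_sq_le (continuous_hamiltonian S M) (fun z hz => ?_) (fun t z => ?_)
  · have h1 : 0 ≤ z.1 ⬝ᵥ (S⁻¹ *ᵥ z.1) := by
      simpa using hS.inv.posSemidef.dotProduct_mulVec_nonneg z.1
    have h2 : 0 ≤ z.2 ⬝ᵥ (M⁻¹ *ᵥ z.2) := by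
      simpa using hM.inv.posSemidef.dotProduct_mulVec_nonneg z.2
    unfold hamiltonian
    by_cases hq : z.1 = 0
    · have hp : z.2 ≠ 0 := fun hp => hz (Prod.ext hq hp)
      linarith [hM.dotProduct_mulVec_inv_pos hp]
    · linarith [hS.dotProduct_mulVec_inv_pos hq]
  · simp [hamiltonian, mulVec_smul]; ring

/-- Reduces integrals to Lebesgue measure with weight exp(-H). The normalisation κ need only be
finite: its value cancels in the integration by parts. -/
theorem exists_invariantMeasure_eq (S M : Matrix (Fin n) (Fin n) ℝ) :
    ∃ κ : ENNReal, κ ≠ ⊤ ∧ invariantMeasure S M =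
      κ • (volume : Measure (PhaseSpace n)).withDensity
        fun z => ENNReal.ofReal (Real.exp (-hamiltonian S M z)) := by
  refine ⟨(gaussianWeight S Set.univ)⁻¹ * (gaussianWeight M Set.univ)⁻¹,
    ENNReal.mul_ne_top (ENNReal.inv_ne_top.2 (gaussianWeight_univ_ne_zero S))
      (ENNReal.inv_ne_top.2 (gaussianWeight_univ_ne_zero M)), ?_⟩
  have : SFinite (gaussianWeight S) := by unfold gaussianWeight; infer_instance
  have : SFinite (gaussianWeight M) := by unfold gaussianWeight; infer_instance
  have h : (gaussianWeight S).prod (gaussianWeight M) =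
      (volume : Measure (PhaseSpace n)).withDensity
        fun z => ENNReal.ofReal (Real.exp (-hamiltonian S M z)) := by
    unfold gaussianWeight
    rw [prod_withDensity (by fun_prop) (by fun_prop)]
    rw [Measure.volume_eq_prod]
    congr 1
    ext z
    rw [← ENNReal.ofReal_mul (Real.exp_pos _).le, ← Real.exp_add, hamiltonian]
    ring_nf
  rw [invariantMeasure, centredGaussian, centredGaussian, Measure.prod_smul_left,
    Measure.prod_smul_right, h, smul_smul]

theorem exists_integral_invariantMeasure_eq (S M : Matrix (Fin n) (Fin n) ℝ) :
    ∃ κ : ℝ, ∀ F : PhaseSpace n → ℝ, ∫ z, F z ∂(invariantMeasure S M) =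
      κ * ∫ z, F z * Real.exp (-hamiltonian S M z) := by
  obtain ⟨κ, -, h⟩ := exists_invariantMeasure_eq S M
  refine ⟨κ.toReal, fun F => ?_⟩
  have := continuous_hamiltonian S M
  rw [h, integral_smul_measure, integral_withDensity_eq_integral_toReal_smul (by fun_prop) (by simp)]
  simp [ENNReal.toReal_ofReal, (Real.exp_pos _).le, mul_comm]

instance isAddHaarMeasure_volume_phaseSpace (n : ℕ) :
    (volume : Measure (PhaseSpace n)).IsAddHaarMeasure :=
  Measure.prod.instIsAddHaarMeasure _ _

theorem Function.HasTemperateGrowth.integrable_invariantMeasure {S M : Matrix (Fin n) (Fin n) ℝ}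
    (hS : S.PosDef) (hM : M.PosDef) {F : PhaseSpace n → ℝ} (hF : F.HasTemperateGrowth) :
    Integrable F (invariantMeasure S M) := by
  obtain ⟨κ, hκ, h⟩ := exists_invariantMeasure_eq S M
  obtain ⟨c, hc, hcQ⟩ := exists_mul_norm_sq_le_hamiltonian hS hM
  have hH := continuous_hamiltonian S M
  rw [h]
  refine Integrable.smul_measure ?_ hκ
  rw [integrable_withDensity_iff_integrable_smul' (by fun_prop) (by simp)]
  have := hF.integrable_mul_exp_neg volume hH hc hcQ
  simpa [ENNReal.toReal_ofReal, (Real.exp_pos _).le, mul_comm] using this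

theorem Function.HasTemperateGrowth.memLp_two_invariantMeasure {S M : Matrix (Fin n) (Fin n) ℝ}
    (hS : S.PosDef) (hM : M.PosDef) {F : PhaseSpace n → ℝ} (hF : F.HasTemperateGrowth) :
    MemLp F 2 (invariantMeasure S M) :=
  (memLp_two_iff_integrable_sq hF.1.continuous.aestronglyMeasurable).2
    ((hF.fun_pow 2).integrable_invariantMeasure hS hM)

theorem hasTemperateGrowth_dotProduct {E : Type*} [NormedAddCommGroup E] [NormedSpace ℝ E]
    {f g : E → Coord n} (hf : f.HasTemperateGrowth) (hg : g.HasTemperateGrowth) :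
    (fun x => f x ⬝ᵥ g x).HasTemperateGrowth := by
  have hc : ∀ (i : Fin n) (f : E → Coord n), f.HasTemperateGrowth →
      (fun x => f x i).HasTemperateGrowth := fun i f hf =>
    (ContinuousLinearMap.proj (R := ℝ) (φ := fun _ : Fin n => ℝ) i).hasTemperateGrowth.comp hf
  unfold dotProduct
  exact .sum fun i _ => (hc i f hf).mul (hc i g hg)

theorem hasTemperateGrowth_apply {E : Type*} [NormedAddCommGroup E] [NormedSpace ℝ E]
    {f : E → Coord n} (hf : f.HasTemperateGrowth) (i : Fin n) :
    (fun x => f x i).HasTemperateGrowth :=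
  (ContinuousLinearMap.proj (R := ℝ) (φ := fun _ : Fin n => ℝ) i).hasTemperateGrowth.comp hf

theorem hasTemperateGrowth_mulVec {E : Type*} [NormedAddCommGroup E] [NormedSpace ℝ E]
    (A : Matrix (Fin n) (Fin n) ℝ) {f : E → Coord n} (hf : f.HasTemperateGrowth) :
    (fun x => A *ᵥ f x).HasTemperateGrowth :=
  (Matrix.mulVecLin A).toContinuousLinearMap.hasTemperateGrowth.comp hf

theorem hasTemperateGrowth_fst : (fun z : PhaseSpace n => z.1).HasTemperateGrowth :=
  (ContinuousLinearMap.fst ℝ (Coord n) (Coord n)).hasTemperateGrowth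

theorem hasTemperateGrowth_snd : (fun z : PhaseSpace n => z.2).HasTemperateGrowth :=
  (ContinuousLinearMap.snd ℝ (Coord n) (Coord n)).hasTemperateGrowth

end Measures

/-! ### Stein's identity and the adjointness of the two generators -/

section IntegrationByParts

variable {n : ℕ}

/-- Serves the Hamiltonian and the quadratic polynomials, and with a = b = 0 functions that are
constant along v: the derivative is read off from the expansion in t. -/
theorem fderiv_apply_eq_of_quadratic {E : Type*} [NormedAddCommGroup E] [NormedSpace ℝ E]
    {F : E → ℝ} {z v : E} (hF : DifferentiableAt ℝ F z) {a b : ℝ}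
    (h : ∀ t : ℝ, F (z + t • v) = F z + t * a + t ^ 2 * b) : fderiv ℝ F z v = a := by
  rw [← hF.lineDeriv_eq_fderiv, lineDeriv]
  simp only [h]
  have := (((hasDerivAt_id (0 : ℝ)).mul_const a).const_add (F z)).add
    (((hasDerivAt_id (0 : ℝ)).pow 2).mul_const b)
  have h2 := this.deriv
  simpa [Pi.add_def] using h2

theorem Matrix.IsSymm.dotProduct_mulVec_comm {A : Matrix (Fin n) (Fin n) ℝ} (hA : A.IsSymm)
    (x y : Coord n) : x ⬝ᵥ (A *ᵥ y) = y ⬝ᵥ (A *ᵥ x) := by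
  rw [dotProduct_mulVec, ← mulVec_transpose, hA.eq, dotProduct_comm]

theorem Matrix.PosDef.isSymm {S : Matrix (Fin n) (Fin n) ℝ} (hS : S.PosDef) : S.IsSymm := by
  have h : Sᴴ = S := hS.isHermitian
  exact (conjTranspose_eq_transpose_of_trivial S).symm.trans h

theorem hasTemperateGrowth_hamiltonian (S M : Matrix (Fin n) (Fin n) ℝ) :
    (hamiltonian S M).HasTemperateGrowth := by
  have h1 := hasTemperateGrowth_dotProduct hasTemperateGrowth_fst
    (hasTemperateGrowth_mulVec S⁻¹ (hasTemperateGrowth_fst (n := n)))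
  have h2 := hasTemperateGrowth_dotProduct hasTemperateGrowth_snd
    (hasTemperateGrowth_mulVec M⁻¹ (hasTemperateGrowth_snd (n := n)))
  unfold hamiltonian
  fun_prop

theorem fderiv_hamiltonian {S M : Matrix (Fin n) (Fin n) ℝ} (hS : S.PosDef) (hM : M.PosDef)
    (z v : PhaseSpace n) : fderiv ℝ (hamiltonian S M) z v =
      v.1 ⬝ᵥ (S⁻¹ *ᵥ z.1) + v.2 ⬝ᵥ (M⁻¹ *ᵥ z.2) := by
  refine fderiv_apply_eq_of_quadratic (b := hamiltonian S M v)
    ((hasTemperateGrowth_hamiltonian S M).1.differentiable (by simp) z) fun t => ?_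
  simp only [hamiltonian, Prod.fst_add, Prod.snd_add, Prod.smul_fst, Prod.smul_snd, mulVec_add,
    mulVec_smul, dotProduct_add, add_dotProduct, smul_dotProduct, dotProduct_smul, smul_eq_mul,
    hS.inv.isSymm.dotProduct_mulVec_comm z.1 v.1, hM.inv.isSymm.dotProduct_mulVec_comm z.2 v.2]
  ring

/-- Stein's identity for the invariant measure. -/
theorem integral_fderiv_invariantMeasure {S M : Matrix (Fin n) (Fin n) ℝ} (hS : S.PosDef)
    (hM : M.PosDef) {F : PhaseSpace n → ℝ} (hF : F.HasTemperateGrowth) (v : PhaseSpace n) :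
    ∫ z, fderiv ℝ F z v ∂(invariantMeasure S M) =
      ∫ z, F z * (v.1 ⬝ᵥ (S⁻¹ *ᵥ z.1) + v.2 ⬝ᵥ (M⁻¹ *ᵥ z.2)) ∂(invariantMeasure S M) := by
  obtain ⟨κ, h⟩ := exists_integral_invariantMeasure_eq S M
  obtain ⟨c, hc, hcQ⟩ := exists_mul_norm_sq_le_hamiltonian hS hM
  have hH := hasTemperateGrowth_hamiltonian S M
  have hHd := hH.1.differentiable (by simp)
  have hint {G : PhaseSpace n → ℝ} (hG : G.HasTemperateGrowth) :=
    hG.integrable_mul_exp_neg volume hH.1.continuous hc hcQ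
  have hd (z : PhaseSpace n) : fderiv ℝ (fun z => Real.exp (-hamiltonian S M z)) z v =
      -(Real.exp (-hamiltonian S M z) * fderiv ℝ (hamiltonian S M) z v) := by
    rw [((hHd z).hasFDerivAt.fun_neg.exp).fderiv]
    simp
  rw [h, h]
  congr 1
  -- Lebesgue integration by parts against exp(-H); differentiating the weight brings down the
  -- linear form of the statement.
  have key := integral_mul_fderiv_eq_neg_fderiv_mul_of_integrable
    (μ := (volume : Measure (PhaseSpace n))) (f := F)
    (g := fun z => Real.exp (-hamiltonian S M z)) (v := v)
    (hint (hF.fderiv_apply v))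
    (by
      simp only [hd]
      refine (hint (hF.mul (hH.fderiv_apply v))).neg.congr (Eventually.of_forall fun z => ?_)
      simp only [Pi.neg_apply, Pi.mul_apply]; ring)
    (hint hF)
    (fun z _ => hF.1.differentiable (by simp) z)
    (fun z _ => (hHd z).fun_neg.exp)
  rw [← neg_eq_iff_eq_neg, ← integral_neg] at key
  rw [← key]
  refine integral_congr_ae (Eventually.of_forall fun z => ?_)
  simp only [hd, fderiv_hamiltonian hS hM]
  ring

theorem integral_mul_fderiv_invariantMeasure {S M : Matrix (Fin n) (Fin n) ℝ} (hS : S.PosDef)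
    (hM : M.PosDef) {u h : PhaseSpace n → ℝ} (hu : u.HasTemperateGrowth)
    (hh : h.HasTemperateGrowth) (v : PhaseSpace n) :
    ∫ z, u z * fderiv ℝ h z v ∂(invariantMeasure S M) =
      ∫ z, (u z * h z * (v.1 ⬝ᵥ (S⁻¹ *ᵥ z.1) + v.2 ⬝ᵥ (M⁻¹ *ᵥ z.2)) -
        fderiv ℝ u z v * h z) ∂(invariantMeasure S M) := by
  have hi1 := (hu.fun_mul (hh.fderiv_apply v)).integrable_invariantMeasure hS hM
  have hi2 := ((hu.fderiv_apply v).fun_mul hh).integrable_invariantMeasure hS hM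
  have hlin : (fun z : PhaseSpace n =>
      v.1 ⬝ᵥ (S⁻¹ *ᵥ z.1) + v.2 ⬝ᵥ (M⁻¹ *ᵥ z.2)).HasTemperateGrowth :=
    (hasTemperateGrowth_dotProduct (.const _)
      (hasTemperateGrowth_mulVec _ hasTemperateGrowth_fst)).fun_add
    (hasTemperateGrowth_dotProduct (.const _)
      (hasTemperateGrowth_mulVec _ hasTemperateGrowth_snd))
  have hi3 := ((hu.fun_mul hh).fun_mul hlin).integrable_invariantMeasure hS hM
  rw [integral_sub hi3 hi2, ← integral_fderiv_invariantMeasure hS hM (hu.fun_mul hh) v,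
    eq_sub_iff_add_eq, ← integral_add hi1 hi2]
  refine integral_congr_ae (Eventually.of_forall fun z => ?_)
  simp only
  rw [fderiv_fun_mul (hu.1.differentiable (by simp) z) (hh.1.differentiable (by simp) z)]
  simp only [_root_.add_apply, _root_.smul_apply, smul_eq_mul]
  ring

/-- Stein's identity concerns constant directions; expanding in the standard basis extends it to
directions that vary with z. -/
theorem derivQ_eq_sum (h : PhaseSpace n → ℝ) (z : PhaseSpace n) (v : Coord n) :
    derivQ h z v = ∑ i, v i * derivQ h z (Pi.single i 1) := by
  have : v = ∑ i, v i • (Pi.single i 1 : Coord n) := by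
    ext j; simp [Finset.sum_apply, Pi.single_apply]
  have h2 : ((v, 0) : PhaseSpace n) = ∑ i, v i • ((Pi.single i 1 : Coord n), (0 : Coord n)) := by
    refine Prod.ext ?_ ?_
    · simpa [Prod.fst_sum] using this
    · simp [Prod.snd_sum]
  simp only [derivQ]
  rw [h2, map_sum]
  exact Finset.sum_congr rfl fun i _ => by rw [map_smul, smul_eq_mul]

theorem derivP_eq_sum (h : PhaseSpace n → ℝ) (z : PhaseSpace n) (v : Coord n) :
    derivP h z v = ∑ i, v i * derivP h z (Pi.single i 1) := by
  have : v = ∑ i, v i • (Pi.single i 1 : Coord n) := by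
    ext j; simp [Finset.sum_apply, Pi.single_apply]
  have h2 : ((0, v) : PhaseSpace n) = ∑ i, v i • ((0 : Coord n), (Pi.single i 1 : Coord n)) := by
    refine Prod.ext ?_ ?_
    · simp [Prod.fst_sum]
    · simpa [Prod.snd_sum] using this
  simp only [derivP]
  rw [h2, map_sum]
  exact Finset.sum_congr rfl fun i _ => by rw [map_smul, smul_eq_mul]

theorem Function.HasTemperateGrowth.derivQ {h : PhaseSpace n → ℝ} (hh : h.HasTemperateGrowth)
    (v : Coord n) : (fun z => derivQ h z v).HasTemperateGrowth := hh.fderiv_apply _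

theorem Function.HasTemperateGrowth.derivP {h : PhaseSpace n → ℝ} (hh : h.HasTemperateGrowth)
    (v : Coord n) : (fun z => derivP h z v).HasTemperateGrowth := hh.fderiv_apply _

theorem Function.HasTemperateGrowth.derivQ_field {h : PhaseSpace n → ℝ}
    (hh : h.HasTemperateGrowth) {W : PhaseSpace n → Coord n} (hW : W.HasTemperateGrowth) :
    (fun z => _root_.derivQ h z (W z)).HasTemperateGrowth := by
  simp only [fun z => derivQ_eq_sum h z (W z)]
  exact .sum fun i _ => (hasTemperateGrowth_apply hW i).fun_mul (hh.derivQ _)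

theorem Function.HasTemperateGrowth.derivP_field {h : PhaseSpace n → ℝ}
    (hh : h.HasTemperateGrowth) {W : PhaseSpace n → Coord n} (hW : W.HasTemperateGrowth) :
    (fun z => _root_.derivP h z (W z)).HasTemperateGrowth := by
  simp only [fun z => derivP_eq_sum h z (W z)]
  exact .sum fun i _ => (hasTemperateGrowth_apply hW i).fun_mul (hh.derivP _)

theorem Function.HasTemperateGrowth.diffusionP (Γ : Matrix (Fin n) (Fin n) ℝ)
    {h : PhaseSpace n → ℝ} (hh : h.HasTemperateGrowth) :
    (_root_.diffusionP Γ h).HasTemperateGrowth := by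
  unfold _root_.diffusionP
  exact .sum fun i _ => .sum fun j _ => .fun_mul (.const _) ((hh.derivP _).derivP _)

theorem Function.HasTemperateGrowth.generator (S Γ M : Matrix (Fin n) (Fin n) ℝ)
    {h : PhaseSpace n → ℝ} (hh : h.HasTemperateGrowth) :
    (_root_.generator S Γ M h).HasTemperateGrowth := by
  have h1 := hh.derivQ_field (hasTemperateGrowth_mulVec M⁻¹ hasTemperateGrowth_snd)
  have h2 := hh.derivP_field (hasTemperateGrowth_mulVec S⁻¹ hasTemperateGrowth_fst)
  have h3 := hh.derivP_field (hasTemperateGrowth_mulVec Γ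
    (hasTemperateGrowth_mulVec M⁻¹ hasTemperateGrowth_snd))
  exact ((h1.fun_sub h2).fun_sub h3).fun_add (hh.diffusionP Γ)

theorem Function.HasTemperateGrowth.adjointGenerator (S Γ M : Matrix (Fin n) (Fin n) ℝ)
    {h : PhaseSpace n → ℝ} (hh : h.HasTemperateGrowth) :
    (_root_.adjointGenerator S Γ M h).HasTemperateGrowth := by
  have h1 := hh.derivQ_field (hasTemperateGrowth_mulVec M⁻¹ hasTemperateGrowth_snd)
  have h2 := hh.derivP_field (hasTemperateGrowth_mulVec S⁻¹ hasTemperateGrowth_fst)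
  have h3 := hh.derivP_field (hasTemperateGrowth_mulVec Γ
    (hasTemperateGrowth_mulVec M⁻¹ hasTemperateGrowth_snd))
  exact ((h1.fun_neg.fun_add h2).fun_sub h3).fun_add (hh.diffusionP Γ)

/-- Integration by parts along the field `z ↦ (W p, 0)`. -/
theorem integral_mul_derivQ_field {S M : Matrix (Fin n) (Fin n) ℝ} (hS : S.PosDef)
    (hM : M.PosDef) {u h : PhaseSpace n → ℝ} (hu : u.HasTemperateGrowth)
    (hh : h.HasTemperateGrowth) {W : Coord n → Coord n}
    (hW : (fun z : PhaseSpace n => W z.2).HasTemperateGrowth) :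
    ∫ z, u z * derivQ h z (W z.2) ∂(invariantMeasure S M) =
      ∫ z, (u z * h z * (W z.2 ⬝ᵥ (S⁻¹ *ᵥ z.1)) - derivQ u z (W z.2) * h z)
        ∂(invariantMeasure S M) := by
  have hW' (i : Fin n) := hasTemperateGrowth_apply hW i
  have hSq := hasTemperateGrowth_mulVec S⁻¹ (hasTemperateGrowth_fst (n := n))
  -- The coefficients W p do not depend on q: the field is divergence-free and the product rule adds
  -- no term.
  have hd (i : Fin n) (z : PhaseSpace n) :
      derivQ (fun z => W z.2 i) z (Pi.single i 1) = 0 :=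
    fderiv_apply_eq_of_quadratic (b := 0) ((hW' i).1.differentiable (by simp) z) (by simp)
  have hterm (i : Fin n) : ∫ z, (u z * W z.2 i) * derivQ h z (Pi.single i 1)
      ∂(invariantMeasure S M) = ∫ z, (u z * h z * (W z.2 i * (S⁻¹ *ᵥ z.1) i) -
        W z.2 i * derivQ u z (Pi.single i 1) * h z) ∂(invariantMeasure S M) := by
    unfold derivQ at hd ⊢
    rw [integral_mul_fderiv_invariantMeasure hS hM (hu.fun_mul (hW' i)) hh]
    refine integral_congr_ae (Eventually.of_forall fun z => ?_)
    simp only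
    rw [fderiv_fun_mul (hu.1.differentiable (by simp) z) ((hW' i).1.differentiable (by simp) z)]
    simp only [_root_.add_apply, _root_.smul_apply, smul_eq_mul, hd,
      single_one_dotProduct, zero_dotProduct]
    ring
  calc _ = ∫ z, ∑ i, (u z * W z.2 i) * derivQ h z (Pi.single i 1) ∂(invariantMeasure S M) := by
        simp only [fun z : PhaseSpace n => derivQ_eq_sum h z (W z.2), Finset.mul_sum, mul_assoc]
    _ = ∑ i, ∫ z, (u z * W z.2 i) * derivQ h z (Pi.single i 1) ∂(invariantMeasure S M) :=
        integral_finsetSum _ fun i _ =>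
          ((hu.fun_mul (hW' i)).fun_mul (hh.derivQ _)).integrable_invariantMeasure hS hM
    _ = _ := by
        simp only [hterm]
        rw [← integral_finsetSum _ fun i _ => (((hu.fun_mul hh).fun_mul
          ((hW' i).fun_mul (hasTemperateGrowth_apply hSq i))).fun_sub
          (((hW' i).fun_mul (hu.derivQ _)).fun_mul hh)).integrable_invariantMeasure hS hM]
        simp only [fun z : PhaseSpace n => derivQ_eq_sum u z (W z.2), Finset.sum_sub_distrib,
          dotProduct, Finset.mul_sum, Finset.sum_mul]

/-- Integration by parts along the field `z ↦ (0, W q)`. -/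
theorem integral_mul_derivP_field {S M : Matrix (Fin n) (Fin n) ℝ} (hS : S.PosDef)
    (hM : M.PosDef) {u h : PhaseSpace n → ℝ} (hu : u.HasTemperateGrowth)
    (hh : h.HasTemperateGrowth) {W : Coord n → Coord n}
    (hW : (fun z : PhaseSpace n => W z.1).HasTemperateGrowth) :
    ∫ z, u z * derivP h z (W z.1) ∂(invariantMeasure S M) =
      ∫ z, (u z * h z * (W z.1 ⬝ᵥ (M⁻¹ *ᵥ z.2)) - derivP u z (W z.1) * h z)
        ∂(invariantMeasure S M) := by
  have hW' (i : Fin n) := hasTemperateGrowth_apply hW i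
  have hMp := hasTemperateGrowth_mulVec M⁻¹ (hasTemperateGrowth_snd (n := n))
  have hd (i : Fin n) (z : PhaseSpace n) :
      derivP (fun z => W z.1 i) z (Pi.single i 1) = 0 :=
    fderiv_apply_eq_of_quadratic (b := 0) ((hW' i).1.differentiable (by simp) z) (by simp)
  have hterm (i : Fin n) : ∫ z, (u z * W z.1 i) * derivP h z (Pi.single i 1)
      ∂(invariantMeasure S M) = ∫ z, (u z * h z * (W z.1 i * (M⁻¹ *ᵥ z.2) i) -
        W z.1 i * derivP u z (Pi.single i 1) * h z) ∂(invariantMeasure S M) := by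
    unfold derivP at hd ⊢
    rw [integral_mul_fderiv_invariantMeasure hS hM (hu.fun_mul (hW' i)) hh]
    refine integral_congr_ae (Eventually.of_forall fun z => ?_)
    simp only
    rw [fderiv_fun_mul (hu.1.differentiable (by simp) z) ((hW' i).1.differentiable (by simp) z)]
    simp only [_root_.add_apply, _root_.smul_apply, smul_eq_mul, hd,
      single_one_dotProduct, zero_dotProduct]
    ring
  calc _ = ∫ z, ∑ i, (u z * W z.1 i) * derivP h z (Pi.single i 1) ∂(invariantMeasure S M) := by
        simp only [fun z : PhaseSpace n => derivP_eq_sum h z (W z.1), Finset.mul_sum, mul_assoc]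
    _ = ∑ i, ∫ z, (u z * W z.1 i) * derivP h z (Pi.single i 1) ∂(invariantMeasure S M) :=
        integral_finsetSum _ fun i _ =>
          ((hu.fun_mul (hW' i)).fun_mul (hh.derivP _)).integrable_invariantMeasure hS hM
    _ = _ := by
        simp only [hterm]
        rw [← integral_finsetSum _ fun i _ => (((hu.fun_mul hh).fun_mul
          ((hW' i).fun_mul (hasTemperateGrowth_apply hMp i))).fun_sub
          (((hW' i).fun_mul (hu.derivP _)).fun_mul hh)).integrable_invariantMeasure hS hM]
        simp only [fun z : PhaseSpace n => derivP_eq_sum u z (W z.1), Finset.sum_sub_distrib,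
          dotProduct, Finset.mul_sum, Finset.sum_mul]

/-- The Dirichlet form of the Ornstein-Uhlenbeck part of the generator. -/
theorem integral_mul_ornsteinUhlenbeck {S Γ M : Matrix (Fin n) (Fin n) ℝ} (hS : S.PosDef)
    (hΓ : Γ.IsSymm) (hM : M.PosDef) {u h : PhaseSpace n → ℝ} (hu : u.HasTemperateGrowth)
    (hh : h.HasTemperateGrowth) :
    ∫ z, u z * (-derivP h z (Γ *ᵥ (M⁻¹ *ᵥ z.2)) + diffusionP Γ h z) ∂(invariantMeasure S M) =
      -∫ z, ∑ i, ∑ j, Γ i j * derivP u z (Pi.single i 1) * derivP h z (Pi.single j 1)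
        ∂(invariantMeasure S M) := by
  have hMp := hasTemperateGrowth_mulVec M⁻¹ (hasTemperateGrowth_snd (n := n))
  have hterm (i j : Fin n) : ∫ z, u z * (Γ i j *
      derivP (fun w => derivP h w (Pi.single j 1)) z (Pi.single i 1)) ∂(invariantMeasure S M) =
      ∫ z, (u z * (derivP h z (Pi.single j 1) * (Γ i j * (M⁻¹ *ᵥ z.2) i)) -
        Γ i j * derivP u z (Pi.single i 1) * derivP h z (Pi.single j 1))
        ∂(invariantMeasure S M) := by
    have := integral_mul_fderiv_invariantMeasure hS hM hu (hh.derivP (Pi.single j 1))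
      (0, Pi.single i 1)
    simp only [fun z => mul_left_comm (u z) (Γ i j), integral_const_mul]
    unfold derivP at this ⊢
    rw [this, ← integral_const_mul]
    refine integral_congr_ae (Eventually.of_forall fun z => ?_)
    simp only [single_one_dotProduct, zero_dotProduct]
    ring
  have hint1 (i j : Fin n) := (hu.fun_mul (.fun_mul (.const (Γ i j))
    ((hh.derivP (Pi.single j 1)).derivP (Pi.single i 1)))).integrable_invariantMeasure hS hM
  have hint2 (i j : Fin n) := ((hu.fun_mul ((hh.derivP (Pi.single j 1)).fun_mul
    (.fun_mul (.const (Γ i j)) (hasTemperateGrowth_apply hMp i)))).fun_sub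
    (.fun_mul (.fun_mul (.const (Γ i j)) (hu.derivP (Pi.single i 1)))
      (hh.derivP (Pi.single j 1)))).integrable_invariantMeasure hS hM
  -- Differentiating the weight in p produces exactly the friction drift Γ M⁻¹ p, which the
  -- first-order term of the Ornstein-Uhlenbeck part cancels.
  have hD : ∫ z, u z * diffusionP Γ h z ∂(invariantMeasure S M) =
      ∫ z, (u z * derivP h z (Γ *ᵥ (M⁻¹ *ᵥ z.2)) - ∑ i, ∑ j, Γ i j *
        derivP u z (Pi.single i 1) * derivP h z (Pi.single j 1)) ∂(invariantMeasure S M) := by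
    simp only [diffusionP, Finset.mul_sum]
    rw [integral_finsetSum _ fun i _ => integrable_finsetSum _ fun j _ => hint1 i j]
    simp only [fun i : Fin n => integral_finsetSum Finset.univ fun j _ => hint1 i j, hterm]
    simp only [← fun i : Fin n => integral_finsetSum Finset.univ fun j _ => hint2 i j]
    rw [← integral_finsetSum _ fun i _ => integrable_finsetSum _ fun j _ => hint2 i j]
    refine integral_congr_ae (Eventually.of_forall fun z => ?_)
    simp only [Finset.sum_sub_distrib]
    congr 1
    rw [derivP_eq_sum, Finset.sum_comm, Finset.mul_sum]
    refine Finset.sum_congr rfl fun j _ => ?_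
    rw [mulVec, dotProduct, ← Finset.mul_sum, ← Finset.mul_sum, mul_comm (derivP _ _ _)]
    simp only [fun i : Fin n => hΓ.apply i j]
  have hi1 := (hu.fun_mul (hh.diffusionP Γ)).integrable_invariantMeasure hS hM
  have hi2 := (hu.fun_mul (hh.derivP_field
    (hasTemperateGrowth_mulVec Γ hMp))).integrable_invariantMeasure hS hM
  have hi3 : Integrable (fun z => ∑ i, ∑ j, Γ i j * derivP u z (Pi.single i 1) *
      derivP h z (Pi.single j 1)) (invariantMeasure S M) :=
    integrable_finsetSum _ fun i _ => integrable_finsetSum _ fun j _ =>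
      (((Function.HasTemperateGrowth.const (Γ i j)).fun_mul (hu.derivP (Pi.single i 1))).fun_mul
        (hh.derivP (Pi.single j 1))).integrable_invariantMeasure hS hM
  rw [integral_sub hi2 hi3] at hD
  simp only [mul_add, mul_neg]
  rw [integral_add hi2.fun_neg hi1, integral_neg, hD]
  ring

/-- The generator and the adjoint generator are formally adjoint on functions of temperate
growth. -/
theorem integral_mul_adjointGenerator {S Γ M : Matrix (Fin n) (Fin n) ℝ} (hS : S.PosDef)
    (hΓ : Γ.IsSymm) (hM : M.PosDef) {u h : PhaseSpace n → ℝ} (hu : u.HasTemperateGrowth)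
    (hh : h.HasTemperateGrowth) :
    ∫ z, u z * adjointGenerator S Γ M h z ∂(invariantMeasure S M) =
      ∫ z, generator S Γ M u z * h z ∂(invariantMeasure S M) := by
  have hMp := hasTemperateGrowth_mulVec M⁻¹ (hasTemperateGrowth_snd (n := n))
  have hSq := hasTemperateGrowth_mulVec S⁻¹ (hasTemperateGrowth_fst (n := n))
  have hΓp := hasTemperateGrowth_mulVec Γ hMp
  have hQ := integral_mul_derivQ_field hS hM hu hh hMp
  have hP := integral_mul_derivP_field hS hM hu hh hSq
  have hOU : ∫ z, u z * (-derivP h z (Γ *ᵥ (M⁻¹ *ᵥ z.2)) + diffusionP Γ h z)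
      ∂(invariantMeasure S M) = ∫ z, h z * (-derivP u z (Γ *ᵥ (M⁻¹ *ᵥ z.2)) + diffusionP Γ u z)
      ∂(invariantMeasure S M) := by
    rw [integral_mul_ornsteinUhlenbeck hS hΓ hM hu hh, integral_mul_ornsteinUhlenbeck hS hΓ hM hh hu]
    congr 1
    refine integral_congr_ae (Eventually.of_forall fun z => ?_)
    simp only
    rw [Finset.sum_comm]
    refine Finset.sum_congr rfl fun j _ => Finset.sum_congr rfl fun i _ => ?_
    rw [hΓ.apply]
    ring
  have hint {F : PhaseSpace n → ℝ} (hF : F.HasTemperateGrowth) :=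
    hF.integrable_invariantMeasure hS hM
  have e1 := hint (hu.fun_mul (hh.derivQ_field hMp))
  have e2 := hint (hu.fun_mul (hh.derivP_field hSq))
  have e3 := hint (hu.fun_mul ((hh.derivP_field hΓp).fun_neg.fun_add (hh.diffusionP Γ)))
  have e1' := hint ((hu.derivQ_field hMp).fun_mul hh)
  have e2' := hint ((hu.derivP_field hSq).fun_mul hh)
  have e3' := hint (hh.fun_mul ((hu.derivP_field hΓp).fun_neg.fun_add (hu.diffusionP Γ)))
  have e5 := hint (((hu.derivQ_field hMp).fun_mul hh).fun_sub ((hu.derivP_field hSq).fun_mul hh))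
  have e4 := hint ((hu.fun_mul hh).fun_mul (hasTemperateGrowth_dotProduct hMp hSq))
  -- Both transport terms leave the same integral of u h (M⁻¹p ⬝ S⁻¹q). They enter with opposite
  -- signs and cancel: the Hamiltonian flow preserves exp(-H).
  rw [integral_sub e4 e1'] at hQ
  simp only [fun z : PhaseSpace n => dotProduct_comm (S⁻¹ *ᵥ z.1) (M⁻¹ *ᵥ z.2)] at hP
  rw [integral_sub e4 e2'] at hP
  calc _ = ∫ z, (-(u z * derivQ h z (M⁻¹ *ᵥ z.2)) + u z * derivP h z (S⁻¹ *ᵥ z.1) +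
        u z * (-derivP h z (Γ *ᵥ (M⁻¹ *ᵥ z.2)) + diffusionP Γ h z)) ∂(invariantMeasure S M) := by
        congr with z
        rw [adjointGenerator]
        ring
    _ = ∫ z, (derivQ u z (M⁻¹ *ᵥ z.2) * h z - derivP u z (S⁻¹ *ᵥ z.1) * h z +
        h z * (-derivP u z (Γ *ᵥ (M⁻¹ *ᵥ z.2)) + diffusionP Γ u z)) ∂(invariantMeasure S M) := by
        rw [integral_add (e1.fun_neg.fun_add e2) e3, integral_add e1.fun_neg e2, integral_neg, hQ, hP, hOU,
          integral_add e5 e3', integral_sub e1' e2']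
        ring
    _ = _ := by
        congr with z
        rw [generator]
        ring

end IntegrationByParts

/-! ### Cutoffs: from compactly supported to temperate test functions -/

section Cutoff

variable {n : ℕ}

theorem derivQ_mul {u h : PhaseSpace n → ℝ} (hu : ContDiff ℝ ∞ u) (hh : ContDiff ℝ ∞ h)
    (z : PhaseSpace n) (v : Coord n) :
    derivQ (fun z => u z * h z) z v = u z * derivQ h z v + h z * derivQ u z v := by
  unfold derivQ
  rw [fderiv_fun_mul (hu.differentiable (by simp) z) (hh.differentiable (by simp) z)]
  rfl

theorem derivP_mul {u h : PhaseSpace n → ℝ} (hu : ContDiff ℝ ∞ u) (hh : ContDiff ℝ ∞ h)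
    (z : PhaseSpace n) (v : Coord n) :
    derivP (fun z => u z * h z) z v = u z * derivP h z v + h z * derivP u z v := by
  unfold derivP
  rw [fderiv_fun_mul (hu.differentiable (by simp) z) (hh.differentiable (by simp) z)]
  rfl

theorem derivP_add {u h : PhaseSpace n → ℝ} (hu : ContDiff ℝ ∞ u) (hh : ContDiff ℝ ∞ h)
    (z : PhaseSpace n) (v : Coord n) :
    derivP (fun z => u z + h z) z v = derivP u z v + derivP h z v := by
  unfold derivP
  rw [fderiv_fun_add (hu.differentiable (by simp) z) (hh.differentiable (by simp) z)]
  rfl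

theorem contDiff_derivP {u : PhaseSpace n → ℝ} (hu : ContDiff ℝ ∞ u) (v : Coord n) :
    ContDiff ℝ ∞ fun z => derivP u z v :=
  (hu.fderiv_right (m := ∞) (by simp)).clm_apply contDiff_const

/-- The two mixed terms of the Leibniz rule coincide because Γ is symmetric, which accounts for the
factor 2. -/
theorem diffusionP_mul {Γ : Matrix (Fin n) (Fin n) ℝ} (hΓ : Γ.IsSymm) {u h : PhaseSpace n → ℝ}
    (hu : ContDiff ℝ ∞ u) (hh : ContDiff ℝ ∞ h) (z : PhaseSpace n) :
    diffusionP Γ (fun z => u z * h z) z = u z * diffusionP Γ h z + h z * diffusionP Γ u z +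
      2 * ∑ i, ∑ j, Γ i j * derivP u z (Pi.single i 1) * derivP h z (Pi.single j 1) := by
  have h1 (i j : Fin n) : Γ i j * derivP (fun w => derivP (fun z => u z * h z) w (Pi.single j 1)) z
      (Pi.single i 1) =
      u z * (Γ i j * derivP (fun w => derivP h w (Pi.single j 1)) z (Pi.single i 1)) +
      h z * (Γ i j * derivP (fun w => derivP u w (Pi.single j 1)) z (Pi.single i 1)) +
      (Γ i j * derivP u z (Pi.single i 1) * derivP h z (Pi.single j 1) +
        Γ j i * derivP u z (Pi.single j 1) * derivP h z (Pi.single i 1)) := by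
    simp only [derivP_mul hu hh]
    rw [derivP_add (hu.mul (contDiff_derivP hh _)) (hh.mul (contDiff_derivP hu _)),
      derivP_mul hu (contDiff_derivP hh _), derivP_mul hh (contDiff_derivP hu _), hΓ.apply]
    ring
  simp only [diffusionP, h1, Finset.sum_add_distrib, Finset.mul_sum]
  rw [Finset.sum_comm (f := fun i j : Fin n => Γ j i * derivP u z (Pi.single j 1) *
    derivP h z (Pi.single i 1))]
  simp only [two_mul, Finset.sum_add_distrib]

theorem adjointGenerator_mul (S M : Matrix (Fin n) (Fin n) ℝ) {Γ : Matrix (Fin n) (Fin n) ℝ}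
    (hΓ : Γ.IsSymm) {u h : PhaseSpace n → ℝ}
    (hu : ContDiff ℝ ∞ u) (hh : ContDiff ℝ ∞ h) (z : PhaseSpace n) :
    adjointGenerator S Γ M (fun z => u z * h z) z =
      u z * adjointGenerator S Γ M h z + (h z * adjointGenerator S Γ M u z +
      2 * ∑ i, ∑ j, Γ i j * derivP u z (Pi.single i 1) * derivP h z (Pi.single j 1)) := by
  simp only [adjointGenerator, derivQ_mul hu hh, derivP_mul hu hh, diffusionP_mul hΓ hu hh]
  ring

theorem derivQ_comp_smul (χ : PhaseSpace n → ℝ) (ε : ℝ) (z : PhaseSpace n) (v : Coord n) :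
    derivQ (fun z => χ (ε • z)) z v = ε * derivQ χ (ε • z) v := by
  simp [derivQ, fderiv_comp_smul]

theorem derivP_comp_smul (χ : PhaseSpace n → ℝ) (ε : ℝ) (z : PhaseSpace n) (v : Coord n) :
    derivP (fun z => χ (ε • z)) z v = ε * derivP χ (ε • z) v := by
  simp [derivP, fderiv_comp_smul]

theorem diffusionP_comp_smul (Γ : Matrix (Fin n) (Fin n) ℝ) {χ : PhaseSpace n → ℝ}
    (hχ : ContDiff ℝ ∞ χ) (ε : ℝ) (z : PhaseSpace n) :
    diffusionP Γ (fun z => χ (ε • z)) z = ε ^ 2 * diffusionP Γ χ (ε • z) := by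
  have h1 (i j : Fin n) : derivP (fun w => ε * derivP χ (ε • w) (Pi.single j 1)) z
      (Pi.single i 1) = ε ^ 2 * derivP (fun w => derivP χ w (Pi.single j 1)) (ε • z)
      (Pi.single i 1) := by
    rw [derivP_mul (u := fun _ => ε) (h := fun w => derivP χ (ε • w) (Pi.single j 1))
      contDiff_const ((contDiff_derivP hχ _).comp (contDiff_const_smul ε)),
      derivP_comp_smul (fun w => derivP χ w (Pi.single j 1))]
    simp [derivP]
    ring
  simp only [diffusionP, derivP_comp_smul, h1, Finset.mul_sum]
  refine Finset.sum_congr rfl fun i _ => Finset.sum_congr rfl fun j _ => by ring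

/-- Each derivative of the rescaled cutoff yields a factor ε, and ε² ≤ ε. The derivatives of χ are
bounded by compact support; the norms on the right come from the drift, whose coefficients are
linear in z. -/
theorem exists_bound_adjointGenerator_comp_smul (S Γ M : Matrix (Fin n) (Fin n) ℝ)
    {χ : PhaseSpace n → ℝ} (hχ : ContDiff ℝ ∞ χ) (hc : HasCompactSupport χ) :
    ∃ D : ℝ, 0 ≤ D ∧ (∀ z i, |derivP χ z (Pi.single i 1)| ≤ D) ∧
      ∀ (ε : ℝ) (z : PhaseSpace n), 0 ≤ ε → ε ≤ 1 →
        |adjointGenerator S Γ M (fun z => χ (ε • z)) z| ≤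
          ε * (D * (‖M⁻¹ *ᵥ z.2‖ + ‖S⁻¹ *ᵥ z.1‖ + ‖Γ *ᵥ (M⁻¹ *ᵥ z.2)‖ + 1)) := by
  obtain ⟨C₁, hC₁⟩ := (hχ.continuous_fderiv (by simp)).bounded_above_of_compact_support
    (hc.fderiv (𝕜 := ℝ))
  have hB (i j : Fin n) : ∃ C, ∀ z, ‖Γ i j * derivP (fun w => derivP χ w (Pi.single j 1)) z
      (Pi.single i 1)‖ ≤ C := by
    refine Continuous.bounded_above_of_compact_support
      (continuous_const.mul (contDiff_derivP (contDiff_derivP hχ _) _).continuous) ?_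
    exact HasCompactSupport.mul_left
      ((hc.fderiv_apply (𝕜 := ℝ) (0, Pi.single j 1)).fderiv_apply (𝕜 := ℝ) (0, Pi.single i 1))
  choose C₂ hC₂ using hB
  have hC₁0 : 0 ≤ C₁ := (norm_nonneg _).trans (hC₁ 0)
  have hC₂0 (i j : Fin n) : 0 ≤ C₂ i j := (norm_nonneg _).trans (hC₂ i j 0)
  have hS0 : 0 ≤ ∑ i, ∑ j, C₂ i j := Finset.sum_nonneg fun i _ => Finset.sum_nonneg fun j _ =>
    hC₂0 i j
  have hQ (z : PhaseSpace n) (v : Coord n) : |derivQ χ z v| ≤ C₁ * ‖v‖ := by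
    refine ((fderiv ℝ χ z).le_opNorm (v, 0)).trans ?_
    rw [Prod.norm_mk, norm_zero, max_eq_left (norm_nonneg v)]
    gcongr
    exact hC₁ z
  have hP (z : PhaseSpace n) (v : Coord n) : |derivP χ z v| ≤ C₁ * ‖v‖ := by
    refine ((fderiv ℝ χ z).le_opNorm (0, v)).trans ?_
    rw [Prod.norm_mk, norm_zero, max_eq_right (norm_nonneg v)]
    gcongr
    exact hC₁ z
  have hD (z : PhaseSpace n) : |diffusionP Γ χ z| ≤ ∑ i, ∑ j, C₂ i j := by
    refine (Finset.abs_sum_le_sum_abs _ _).trans (Finset.sum_le_sum fun i _ => ?_)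
    exact (Finset.abs_sum_le_sum_abs _ _).trans (Finset.sum_le_sum fun j _ => hC₂ i j z)
  refine ⟨C₁ + ∑ i, ∑ j, C₂ i j, by positivity, fun z i => ?_, fun ε z hε hε1 => ?_⟩
  · refine (hP z _).trans ?_
    have h1 : ‖(Pi.single i 1 : Coord n)‖ ≤ 1 := by
      refine (pi_norm_le_iff_of_nonneg zero_le_one).2 fun j => ?_
      rw [Pi.single_apply]
      split_ifs <;> simp
    have := mul_le_of_le_one_right hC₁0 h1
    linarith
  · rw [adjointGenerator, derivQ_comp_smul, derivP_comp_smul, derivP_comp_smul,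
      diffusionP_comp_smul Γ hχ]
    have e : -(ε * derivQ χ (ε • z) (M⁻¹ *ᵥ z.2)) + ε * derivP χ (ε • z) (S⁻¹ *ᵥ z.1) -
        ε * derivP χ (ε • z) (Γ *ᵥ (M⁻¹ *ᵥ z.2)) + ε ^ 2 * diffusionP Γ χ (ε • z) =
        ε * (-derivQ χ (ε • z) (M⁻¹ *ᵥ z.2) + derivP χ (ε • z) (S⁻¹ *ᵥ z.1) -
        derivP χ (ε • z) (Γ *ᵥ (M⁻¹ *ᵥ z.2)) + ε * diffusionP Γ χ (ε • z)) := by ring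
    rw [e, abs_mul, abs_of_nonneg hε]
    gcongr
    have a1 := hQ (ε • z) (M⁻¹ *ᵥ z.2)
    have a2 := hP (ε • z) (S⁻¹ *ᵥ z.1)
    have a3 := hP (ε • z) (Γ *ᵥ (M⁻¹ *ᵥ z.2))
    have a4 : |ε * diffusionP Γ χ (ε • z)| ≤ ∑ i, ∑ j, C₂ i j := by
      rw [abs_mul, abs_of_nonneg hε]
      exact (mul_le_of_le_one_left (abs_nonneg _) hε1).trans (hD _)
    have a5 := abs_add_le (-derivQ χ (ε • z) (M⁻¹ *ᵥ z.2) + derivP χ (ε • z) (S⁻¹ *ᵥ z.1) -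
        derivP χ (ε • z) (Γ *ᵥ (M⁻¹ *ᵥ z.2))) (ε * diffusionP Γ χ (ε • z))
    have a6 := abs_sub (-derivQ χ (ε • z) (M⁻¹ *ᵥ z.2) + derivP χ (ε • z) (S⁻¹ *ᵥ z.1))
        (derivP χ (ε • z) (Γ *ᵥ (M⁻¹ *ᵥ z.2)))
    have a7 := abs_add_le (-derivQ χ (ε • z) (M⁻¹ *ᵥ z.2)) (derivP χ (ε • z) (S⁻¹ *ᵥ z.1))
    rw [abs_neg] at a7
    have b1 := mul_nonneg hS0 (norm_nonneg (M⁻¹ *ᵥ z.2))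
    have b2 := mul_nonneg hS0 (norm_nonneg (S⁻¹ *ᵥ z.1))
    have b3 := mul_nonneg hS0 (norm_nonneg (Γ *ᵥ (M⁻¹ *ᵥ z.2)))
    linarith

/-- The norm is not smooth, so temperate growth does not apply to the product itself; square
integrability passes from the coordinates of the smooth field `h z • W z`. -/
theorem memLp_norm_mul_norm {S M : Matrix (Fin n) (Fin n) ℝ} (hS : S.PosDef) (hM : M.PosDef)
    {h : PhaseSpace n → ℝ} (hh : h.HasTemperateGrowth) {W : PhaseSpace n → Coord n}
    (hW : W.HasTemperateGrowth) :
    MemLp (fun z => |h z| * ‖W z‖) 2 (invariantMeasure S M) := by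
  have h2 : MemLp (fun z => h z • W z) 2 (invariantMeasure S M) :=
    MemLp.of_eval fun i => (hh.fun_mul (hasTemperateGrowth_apply hW i)).memLp_two_invariantMeasure
      hS hM
  simpa [norm_smul] using h2.norm

theorem hasTemperateGrowth_centredObservable (S U₀ : Matrix (Fin n) (Fin n) ℝ) (l : Coord n) :
    (fun z : PhaseSpace n => centredObservable S U₀ l z.1).HasTemperateGrowth := by
  have h1 := hasTemperateGrowth_dotProduct hasTemperateGrowth_fst
    (hasTemperateGrowth_mulVec U₀ (hasTemperateGrowth_fst (n := n)))
  have h2 := hasTemperateGrowth_dotProduct (.const l) (hasTemperateGrowth_fst (n := n))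
  unfold centredObservable quadObservable
  fun_prop

/-- A weak solution may be tested against every function of temperate growth. -/
theorem IsPoissonSolution.weak_eq_of_hasTemperateGrowth {S Γ M U₀ : Matrix (Fin n) (Fin n) ℝ}
    {l : Coord n} {φ : PhaseSpace n → ℝ} (hφ : IsPoissonSolution S Γ M U₀ l φ) (hS : S.PosDef)
    (hΓ : Γ.IsSymm) (hM : M.PosDef) {h : PhaseSpace n → ℝ} (hh : h.HasTemperateGrowth) :
    -∫ z, φ z * adjointGenerator S Γ M h z ∂(invariantMeasure S M) =
      ∫ z, centredObservable S U₀ l z.1 * h z ∂(invariantMeasure S M) := by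
  -- A bump equal to 1 on the unit ball; its rescalings χ(z / (k + 1)) tend to 1 pointwise.
  let χ : ContDiffBump (0 : PhaseSpace n) := ⟨1, 2, one_pos, one_lt_two⟩
  have hχ : ContDiff ℝ ∞ χ := χ.contDiff
  obtain ⟨D, hD0, hD1, hD2⟩ :=
    exists_bound_adjointGenerator_comp_smul S Γ M hχ χ.hasCompactSupport
  let ε : ℕ → ℝ := fun k => 1 / ((k : ℝ) + 1)
  have hε : Tendsto ε atTop (𝓝 0) := tendsto_one_div_add_atTop_nhds_zero_nat
  have hε0 (k : ℕ) : 0 < ε k := by positivity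
  have hε1 (k : ℕ) : ε k ≤ 1 := by
    simp only [ε]
    rw [div_le_one (by positivity)]
    linarith [(Nat.cast_nonneg k : (0 : ℝ) ≤ k)]
  let χs : ℕ → PhaseSpace n → ℝ := fun k z => χ (ε k • z)
  have hχs (k : ℕ) : ContDiff ℝ ∞ (χs k) := hχ.comp (contDiff_const_smul (ε k))
  have hχs1 (k : ℕ) (z : PhaseSpace n) : |χs k z| ≤ 1 := by
    rw [abs_of_nonneg χ.nonneg]
    exact χ.le_one
  have hχslim (z : PhaseSpace n) : Tendsto (fun k => χs k z) atTop (𝓝 1) := by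
    have h1 : Tendsto (fun k => ε k • z) atTop (𝓝 0) := by simpa using hε.smul_const z
    have h2 : χ (0 : PhaseSpace n) = 1 := χ.one_of_mem_closedBall (by simp [χ])
    have := (hχ.continuous.tendsto 0).comp h1
    rwa [h2] at this
  have hweak (k : ℕ) := hφ.weak_eq (fun z => χs k z * h z) ((hχs k).mul hh.1)
    ((χ.hasCompactSupport.comp_smul (hε0 k).ne').mul_right)
  -- the bound for the commutator
  let B : PhaseSpace n → ℝ := fun z =>
    D * (|h z| * ‖M⁻¹ *ᵥ z.2‖ + |h z| * ‖S⁻¹ *ᵥ z.1‖ + |h z| * ‖Γ *ᵥ (M⁻¹ *ᵥ z.2)‖ + |h z|) +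
      2 * D * ∑ i, ∑ j, |Γ i j| * |derivP h z (Pi.single j 1)|
  have hB (k : ℕ) (z : PhaseSpace n) :
      |adjointGenerator S Γ M (fun z => χs k z * h z) z - χs k z * adjointGenerator S Γ M h z| ≤
        ε k * B z := by
    rw [adjointGenerator_mul S M hΓ (hχs k) hh.1, add_sub_cancel_left]
    have a1 : |h z * adjointGenerator S Γ M (χs k) z| ≤ ε k * (D * (|h z| * ‖M⁻¹ *ᵥ z.2‖ +
        |h z| * ‖S⁻¹ *ᵥ z.1‖ + |h z| * ‖Γ *ᵥ (M⁻¹ *ᵥ z.2)‖ + |h z|)) := by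
      rw [abs_mul]
      refine (mul_le_mul_of_nonneg_left (hD2 (ε k) z (hε0 k).le (hε1 k)) (abs_nonneg _)).trans
        (le_of_eq ?_)
      ring
    have a2 : |∑ i, ∑ j, Γ i j * derivP (χs k) z (Pi.single i 1) * derivP h z (Pi.single j 1)| ≤
        ε k * (D * ∑ i, ∑ j, |Γ i j| * |derivP h z (Pi.single j 1)|) := by
      simp only [Finset.mul_sum]
      refine (Finset.abs_sum_le_sum_abs _ _).trans (Finset.sum_le_sum fun i _ => ?_)
      refine (Finset.abs_sum_le_sum_abs _ _).trans (Finset.sum_le_sum fun j _ => ?_)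
      rw [derivP_comp_smul, abs_mul, abs_mul, abs_mul, abs_of_pos (hε0 k)]
      calc _ ≤ |Γ i j| * (ε k * D) * |derivP h z (Pi.single j 1)| := by
            gcongr
            exact hD1 _ _
        _ = _ := by ring
    refine (abs_add_le _ _).trans ?_
    rw [abs_mul 2, abs_of_pos (two_pos : (0 : ℝ) < 2)]
    simp only [B]
    linarith
  have hB0 (z : PhaseSpace n) : 0 ≤ B z := by
    have := (abs_nonneg _).trans (hB 0 z)
    exact (mul_nonneg_iff_of_pos_left (hε0 0)).1 this
  have hMp := hasTemperateGrowth_mulVec M⁻¹ (hasTemperateGrowth_snd (n := n))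
  have hSq := hasTemperateGrowth_mulVec S⁻¹ (hasTemperateGrowth_fst (n := n))
  have hΓp := hasTemperateGrowth_mulVec Γ hMp
  have hBL : MemLp B 2 (invariantMeasure S M) := by
    refine MemLp.add (MemLp.const_mul (((MemLp.add (memLp_norm_mul_norm hS hM hh hMp)
      (memLp_norm_mul_norm hS hM hh hSq)).add (memLp_norm_mul_norm hS hM hh hΓp)).add
      (hh.memLp_two_invariantMeasure hS hM).abs) D) (MemLp.const_mul ?_ (2 * D))
    exact memLp_finsetSum _ fun i _ => memLp_finsetSum _ fun j _ =>
      ((hh.derivP _).memLp_two_invariantMeasure hS hM).abs.const_mul _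
  have hL := (hh.adjointGenerator S Γ M).memLp_two_invariantMeasure hS hM
  -- The commutator is at most ε_k B with B in L². As ε_k ≤ 1, the bound |φ| (|𝓛*h| + B) is
  -- independent of k, and it is integrable as a product of two L² functions.
  have lim1 : Tendsto (fun k => ∫ z, φ z * adjointGenerator S Γ M (fun z => χs k z * h z) z
      ∂(invariantMeasure S M)) atTop
      (𝓝 (∫ z, φ z * adjointGenerator S Γ M h z ∂(invariantMeasure S M))) := by
    refine tendsto_integral_of_dominated_convergence
      (fun z => |φ z| * (|adjointGenerator S Γ M h z| + B z)) (fun k => ?_) ?_ (fun k => ?_) ?_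
    · refine hφ.memLp.1.mul ?_
      exact ((((χ.hasCompactSupport.comp_smul (hε0 k).ne').mul_right (f' := h)).hasTemperateGrowth
        ((hχs k).mul hh.1)).adjointGenerator S Γ M).1.continuous.aestronglyMeasurable
    · exact MemLp.integrable_mul hφ.memLp.abs (hL.abs.add hBL)
    · refine Eventually.of_forall fun z => ?_
      rw [norm_mul, Real.norm_eq_abs, Real.norm_eq_abs]
      gcongr
      have a1 := hB k z
      have a2 := abs_add_le (χs k z * adjointGenerator S Γ M h z)
        (adjointGenerator S Γ M (fun z => χs k z * h z) z - χs k z * adjointGenerator S Γ M h z)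
      rw [add_sub_cancel] at a2
      have a3 : |χs k z * adjointGenerator S Γ M h z| ≤ |adjointGenerator S Γ M h z| := by
        rw [abs_mul]
        exact mul_le_of_le_one_left (abs_nonneg _) (hχs1 k z)
      have a4 : ε k * B z ≤ B z := mul_le_of_le_one_left (hB0 z) (hε1 k)
      linarith
    · refine Eventually.of_forall fun z => Tendsto.const_mul _ ?_
      have a1 : Tendsto (fun k => adjointGenerator S Γ M (fun z => χs k z * h z) z -
          χs k z * adjointGenerator S Γ M h z) atTop (𝓝 0) :=
        squeeze_zero_norm (fun k => hB k z) (by simpa using hε.mul_const (B z))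
      simpa using a1.add ((hχslim z).mul_const (adjointGenerator S Γ M h z))
  have hf := hasTemperateGrowth_centredObservable S U₀ l
  have lim2 : Tendsto (fun k => ∫ z, centredObservable S U₀ l z.1 * (χs k z * h z)
      ∂(invariantMeasure S M)) atTop
      (𝓝 (∫ z, centredObservable S U₀ l z.1 * h z ∂(invariantMeasure S M))) := by
    refine tendsto_integral_of_dominated_convergence
      (fun z => |centredObservable S U₀ l z.1 * h z|) (fun k => ?_) ?_ (fun k => ?_) ?_
    · exact (hf.1.continuous.mul ((hχs k).continuous.mul hh.1.continuous)).aestronglyMeasurable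
    · exact ((hf.fun_mul hh).integrable_invariantMeasure hS hM).abs
    · refine Eventually.of_forall fun z => ?_
      rw [mul_left_comm, norm_mul]
      exact mul_le_of_le_one_left (abs_nonneg _) (hχs1 k z)
    · refine Eventually.of_forall fun z => Tendsto.const_mul _ ?_
      simpa using (hχslim z).mul_const (h z)
  exact tendsto_nhds_unique (lim1.neg.congr fun k => hweak k) lim2

end Cutoff

/-! ### The Lyapunov system: solvability, energy identity, overdamped comparison -/

section Lyapunov

variable {n : ℕ}

open scoped MatrixOrder in
-- Factor Γ = DᵀD and S = EᵀE. By cyclicity of the trace the form is the squared Frobenius norm of E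
-- b Dᵀ, so it is positive, and definite since both factors are invertible.
theorem exists_trace_mul_eq_trace_sq {Γ S : Matrix (Fin n) (Fin n) ℝ} (hΓ : Γ.PosDef)
    (hS : S.PosDef) : ∃ D E : Matrix (Fin n) (Fin n) ℝ, IsUnit D ∧ IsUnit E ∧
      ∀ b : Matrix (Fin n) (Fin n) ℝ,
        (Γ * bᵀ * S * b).trace = ((E * b * D)ᵀ * (E * b * D)).trace := by
  obtain ⟨D, hD, hΓD⟩ :=
    CStarAlgebra.isStrictlyPositive_iff_eq_star_mul_self.mp hΓ.isStrictlyPositive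
  obtain ⟨E, hE, hSE⟩ :=
    CStarAlgebra.isStrictlyPositive_iff_eq_star_mul_self.mp hS.isStrictlyPositive
  rw [star_eq_conjTranspose, conjTranspose_eq_transpose_of_trivial] at hΓD hSE
  refine ⟨Dᵀ, E, (isUnit_transpose D).2 hD, hE, fun b => ?_⟩
  rw [hΓD, hSE]
  simp only [transpose_mul, transpose_transpose, Matrix.mul_assoc]
  rw [trace_mul_comm Dᵀ]
  simp only [Matrix.mul_assoc]

theorem trace_mul_transpose_mul_mul_nonneg {Γ S : Matrix (Fin n) (Fin n) ℝ} (hΓ : Γ.PosDef)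
    (hS : S.PosDef) (b : Matrix (Fin n) (Fin n) ℝ) : 0 ≤ (Γ * bᵀ * S * b).trace := by
  obtain ⟨D, E, -, -, h⟩ := exists_trace_mul_eq_trace_sq hΓ hS
  rw [h]
  have := (posSemidef_conjTranspose_mul_self (E * b * D)).trace_nonneg
  rwa [conjTranspose_eq_transpose_of_trivial] at this

theorem eq_zero_of_trace_mul_transpose_mul_mul {Γ S : Matrix (Fin n) (Fin n) ℝ} (hΓ : Γ.PosDef)
    (hS : S.PosDef) {b : Matrix (Fin n) (Fin n) ℝ} (hb : (Γ * bᵀ * S * b).trace = 0) : b = 0 := by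
  obtain ⟨D, E, hD, hE, h⟩ := exists_trace_mul_eq_trace_sq hΓ hS
  rw [h, ← conjTranspose_eq_transpose_of_trivial, trace_conjTranspose_mul_self_eq_zero_iff,
    hD.mul_left_eq_zero, hE.mul_right_eq_zero] at hb
  exact hb

/-- Transposition turns tr(a bᵀ S) into tr(a S b), so the two halves of W contribute equally. -/
theorem trace_mul_eq_two_mul {S a b W : Matrix (Fin n) (Fin n) ℝ} (hS : S.IsSymm) (ha : a.IsSymm)
    (hb : bᵀ * S + S * b = W) : (a * W).trace = 2 * (a * S * b).trace := by
  have : (a * (bᵀ * S)).trace = (a * S * b).trace := by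
    rw [← trace_transpose]
    simp only [transpose_mul, transpose_transpose, ha.eq, hS.eq]
    rw [trace_mul_comm, Matrix.mul_assoc]
  rw [← hb, Matrix.mul_add, trace_add, this, Matrix.mul_assoc]
  ring

/-- The Lyapunov equation for a quadratic solution of the Poisson equation, in blocks. -/
structure IsLyapunovSolution (S Γ M W a b c : Matrix (Fin n) (Fin n) ℝ) : Prop where
  symm_a : a.IsSymm
  symm_c : c.IsSymm
  eq_qq : bᵀ * S + S * b = W
  eq_qp : S * a = S * b * Γ + c * M
  eq_pp : b * M + M * bᵀ = Γ * c * M + M * c * Γ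

theorem IsLyapunovSolution.mul_eq {S Γ M W a b c : Matrix (Fin n) (Fin n) ℝ}
    (h : IsLyapunovSolution S Γ M W a b c) (hS : S.IsSymm) (hΓ : Γ.IsSymm) (hM : M.IsSymm) :
    a * S = Γ * bᵀ * S + M * c := by
  have := congrArg transpose h.eq_qp
  simpa [transpose_mul, h.symm_a.eq, h.symm_c.eq, hS.eq, hΓ.eq, hM.eq, Matrix.mul_assoc] using this

/-- Multiply the pp equation by c and take traces: each side is twice one of the two quantities. -/
theorem IsLyapunovSolution.trace_mul_mul {S Γ M W a b c : Matrix (Fin n) (Fin n) ℝ}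
    (h : IsLyapunovSolution S Γ M W a b c) (hM : M.IsSymm) :
    (M * c * b).trace = (Γ * cᵀ * M * c).trace := by
  have h1 := congrArg (fun x => (x * c).trace) h.eq_pp
  simp only [Matrix.add_mul, trace_add] at h1
  have e1 : (b * M * c).trace = (M * c * b).trace := by
    rw [Matrix.mul_assoc, trace_mul_comm]
  have e2 : (M * bᵀ * c).trace = (M * c * b).trace := by
    rw [← trace_transpose]
    simp only [transpose_mul, transpose_transpose, h.symm_c.eq, hM.eq]
    rw [← Matrix.mul_assoc, trace_mul_comm, ← Matrix.mul_assoc]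
  have e3 : (M * c * Γ * c).trace = (Γ * c * M * c).trace := by
    rw [Matrix.mul_assoc (M * c), trace_mul_comm, ← Matrix.mul_assoc]
  rw [h.symm_c.eq]
  linarith

/-- The energy identity: in 2 tr(a S b) replace a S by the transposed qp equation and use the pp
equation for the remaining term. -/
theorem IsLyapunovSolution.trace_eq {S Γ M W a b c : Matrix (Fin n) (Fin n) ℝ}
    (h : IsLyapunovSolution S Γ M W a b c) (hS : S.IsSymm) (hΓ : Γ.IsSymm) (hM : M.IsSymm) :
    (a * W).trace = 2 * ((Γ * bᵀ * S * b).trace + (Γ * cᵀ * M * c).trace) := by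
  rw [trace_mul_eq_two_mul hS h.symm_a h.eq_qq, h.mul_eq hS hΓ hM, Matrix.add_mul, trace_add,
    h.trace_mul_mul hM]

/-- The symmetric matrices. -/
def symmSubmodule (n : ℕ) : Submodule ℝ (Matrix (Fin n) (Fin n) ℝ) where
  carrier := {A | A.IsSymm}
  add_mem' h1 h2 := h1.add h2
  zero_mem' := isSymm_zero
  smul_mem' t _ h := h.smul t

/-- Unknowns and residuals both range over Sym × Mat × Sym, so injectivity suffices. For W = 0 the
energy identity forces b = c = 0, and the qp equation then gives S a = 0. -/
theorem exists_isLyapunovSolution {S Γ M W : Matrix (Fin n) (Fin n) ℝ} (hS : S.PosDef)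
    (hΓ : Γ.PosDef) (hM : M.PosDef) (hW : W.IsSymm) :
    ∃ a b c, IsLyapunovSolution S Γ M W a b c := by
  have hS' := hS.isSymm
  have hΓ' := hΓ.isSymm
  have hM' := hM.isSymm
  let T : symmSubmodule n × Matrix (Fin n) (Fin n) ℝ × symmSubmodule n →ₗ[ℝ]
      symmSubmodule n × Matrix (Fin n) (Fin n) ℝ × symmSubmodule n :=
    { toFun := fun x =>
        (⟨x.2.1ᵀ * S + S * x.2.1, by
            change Matrix.IsSymm _
            simp [Matrix.IsSymm, transpose_mul, hS'.eq, add_comm]⟩,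
          S * x.1.1 - S * x.2.1 * Γ - x.2.2.1 * M,
          ⟨x.2.1 * M + M * x.2.1ᵀ - (Γ * x.2.2.1 * M + M * x.2.2.1 * Γ), by
            have hc : (x.2.2.1)ᵀ = x.2.2.1 := x.2.2.2
            change Matrix.IsSymm _
            simp [Matrix.IsSymm, transpose_mul, hΓ'.eq, hM'.eq, hc, add_comm, Matrix.mul_assoc]⟩)
      map_add' := fun x y => by
        refine Prod.ext (Subtype.ext ?_) (Prod.ext ?_ (Subtype.ext ?_)) <;>
          simp [Matrix.mul_add, Matrix.add_mul] <;> abel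
      map_smul' := fun t x => by
        refine Prod.ext (Subtype.ext ?_) (Prod.ext ?_ (Subtype.ext ?_)) <;>
          simp [smul_sub, smul_add] }
  have hT (x : symmSubmodule n × Matrix (Fin n) (Fin n) ℝ × symmSubmodule n) (W : symmSubmodule n) (hx : T x = (W, 0, 0)) :
      IsLyapunovSolution S Γ M W.1 x.1.1 x.2.1 x.2.2.1 := by
    have h1 := congrArg (fun y : symmSubmodule n × Matrix (Fin n) (Fin n) ℝ × symmSubmodule n => y.1.1) hx
    have h2 := congrArg (fun y : symmSubmodule n × Matrix (Fin n) (Fin n) ℝ × symmSubmodule n => y.2.1) hx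
    have h3 := congrArg (fun y : symmSubmodule n × Matrix (Fin n) (Fin n) ℝ × symmSubmodule n => y.2.2.1) hx
    simp only [T, LinearMap.coe_mk, AddHom.coe_mk] at h1 h2 h3
    exact ⟨x.1.2, x.2.2.2, h1, by rw [sub_sub, sub_eq_zero] at h2; exact h2, sub_eq_zero.1 h3⟩
  have hinj : Function.Injective T := by
    rw [← LinearMap.ker_eq_bot, LinearMap.ker_eq_bot']
    intro x hx
    have h := hT x 0 hx
    have ht := h.trace_eq hS' hΓ' hM'
    have p1 := trace_mul_transpose_mul_mul_nonneg hΓ hS x.2.1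
    have p2 := trace_mul_transpose_mul_mul_nonneg hΓ hM x.2.2.1
    simp only [Submodule.coe_zero, Matrix.mul_zero, trace_zero] at ht
    have hb := eq_zero_of_trace_mul_transpose_mul_mul hΓ hS (b := x.2.1) (by linarith)
    have hc := eq_zero_of_trace_mul_transpose_mul_mul hΓ hM (b := x.2.2.1) (by linarith)
    have ha := h.eq_qp
    rw [hb, hc] at ha
    simp only [Matrix.mul_zero, Matrix.zero_mul, add_zero] at ha
    rw [hS.isUnit.mul_right_eq_zero] at ha
    exact Prod.ext (Subtype.ext ha) (Prod.ext hb (Subtype.ext hc))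
  obtain ⟨x, hx⟩ := LinearMap.injective_iff_surjective.1 hinj (⟨W, hW⟩, 0, 0)
  exact ⟨_, _, _, hT x _ hx⟩

/-- The Lyapunov equation of the overdamped limit. -/
theorem exists_overdamped_solution {S Γ W : Matrix (Fin n) (Fin n) ℝ} (hS : S.PosDef)
    (hΓ : Γ.PosDef) (hW : W.IsSymm) :
    ∃ b : Matrix (Fin n) (Fin n) ℝ, (b * Γ).IsSymm ∧ bᵀ * S + S * b = W := by
  have hS' := hS.isSymm
  have hΓ' := hΓ.isSymm
  have hΓi := hΓ.inv.isSymm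
  -- The unknown is the symmetric matrix x = b Γ, which plays the role of the block a.
  let T : symmSubmodule n →ₗ[ℝ] symmSubmodule n :=
    { toFun := fun x => ⟨(x.1 * Γ⁻¹)ᵀ * S + S * (x.1 * Γ⁻¹), by
        change Matrix.IsSymm _
        simp [Matrix.IsSymm, transpose_mul, hS'.eq, add_comm]⟩
      map_add' := fun x y => by
        refine Subtype.ext ?_
        simp [Matrix.mul_add, Matrix.add_mul]
        abel
      map_smul' := fun t x => by
        refine Subtype.ext ?_
        simp [smul_add] }
  have hΓu : IsUnit Γ.det := (isUnit_iff_isUnit_det _).1 hΓ.isUnit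
  have hx' (x : symmSubmodule n) : x.1 * Γ⁻¹ * Γ = x.1 := by
    rw [Matrix.mul_assoc, nonsing_inv_mul _ hΓu, Matrix.mul_one]
  have hinj : Function.Injective T := by
    rw [← LinearMap.ker_eq_bot, LinearMap.ker_eq_bot']
    intro x hx
    have h1 : (x.1 * Γ⁻¹)ᵀ * S + S * (x.1 * Γ⁻¹) = 0 := congrArg Subtype.val hx
    have h2 := trace_mul_eq_two_mul hS' x.2 h1
    have h3 : Γ * (x.1 * Γ⁻¹)ᵀ = x.1 := by
      have h4 : (x.1)ᵀ = x.1 := x.2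
      rw [transpose_mul, hΓi.eq, ← Matrix.mul_assoc, mul_nonsing_inv _ hΓu, Matrix.one_mul, h4]
    have hb := eq_zero_of_trace_mul_transpose_mul_mul hΓ hS (b := x.1 * Γ⁻¹) (by
      rw [h3]
      simpa using h2.symm)
    refine Subtype.ext ?_
    rw [← hx' x, hb, Matrix.zero_mul]
    rfl
  obtain ⟨x, hx⟩ := LinearMap.injective_iff_surjective.1 hinj ⟨W, hW⟩
  refine ⟨x.1 * Γ⁻¹, ?_, congrArg Subtype.val hx⟩
  rw [hx']
  exact x.2

/-- The left side does not involve b: in the inner product tr(Γ xᵀ S y), b₀ pairs equally with all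
solutions b of the constraint. If b₀ is itself a solution, it is orthogonal to b - b₀ and is the
solution of least norm. -/
theorem trace_overdamped_eq {S Γ W b b₀ : Matrix (Fin n) (Fin n) ℝ} (hS : S.IsSymm)
    (hΓ : Γ.IsSymm) (hb₀ : (b₀ * Γ).IsSymm) (hb : bᵀ * S + S * b = W) :
    (b₀ * Γ * W).trace = 2 * (Γ * b₀ᵀ * S * b).trace := by
  rw [trace_mul_eq_two_mul hS hb₀ hb, ← hb₀.eq, transpose_mul, hΓ.eq]

theorem trace_mul_transpose_mul_mul_comm {S Γ : Matrix (Fin n) (Fin n) ℝ} (hS : S.IsSymm)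
    (hΓ : Γ.IsSymm) (x y : Matrix (Fin n) (Fin n) ℝ) :
    (Γ * xᵀ * S * y).trace = (Γ * yᵀ * S * x).trace := by
  rw [← trace_transpose]
  simp only [transpose_mul, transpose_transpose, hS.eq, hΓ.eq]
  rw [← Matrix.mul_assoc, ← Matrix.mul_assoc, trace_mul_comm]
  simp only [Matrix.mul_assoc]

theorem trace_mul_transpose_sub_mul_sub {S Γ : Matrix (Fin n) (Fin n) ℝ} (hS : S.IsSymm)
    (hΓ : Γ.IsSymm) (x y : Matrix (Fin n) (Fin n) ℝ) :
    (Γ * (x - y)ᵀ * S * (x - y)).trace =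
      (Γ * xᵀ * S * x).trace - 2 * (Γ * yᵀ * S * x).trace + (Γ * yᵀ * S * y).trace := by
  simp only [transpose_sub, Matrix.mul_sub, Matrix.sub_mul, trace_sub]
  rw [trace_mul_transpose_mul_mul_comm hS hΓ x y]
  ring

/-- The excess of the underdamped over the overdamped variance. -/
theorem IsLyapunovSolution.trace_eq_overdamped_add {S Γ M W a b c b₀ : Matrix (Fin n) (Fin n) ℝ}
    (h : IsLyapunovSolution S Γ M W a b c) (hS : S.IsSymm) (hΓ : Γ.IsSymm) (hM : M.IsSymm)
    (hb₀ : (b₀ * Γ).IsSymm) (hb₀W : b₀ᵀ * S + S * b₀ = W) :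
    (a * W).trace = (b₀ * Γ * W).trace +
      2 * ((Γ * (b - b₀)ᵀ * S * (b - b₀)).trace + (Γ * cᵀ * M * c).trace) := by
  have h1 := h.trace_eq hS hΓ hM
  have h2 := trace_overdamped_eq hS hΓ hb₀ h.eq_qq
  have h3 := trace_overdamped_eq hS hΓ hb₀ hb₀W
  rw [trace_mul_transpose_sub_mul_sub hS hΓ]
  linarith

theorem IsLyapunovSolution.overdamped_le {S Γ M W a b c b₀ : Matrix (Fin n) (Fin n) ℝ}
    (h : IsLyapunovSolution S Γ M W a b c) (hS : S.PosDef) (hΓ : Γ.PosDef) (hM : M.PosDef)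
    (hb₀ : (b₀ * Γ).IsSymm) (hb₀W : b₀ᵀ * S + S * b₀ = W) :
    (b₀ * Γ * W).trace ≤ (a * W).trace := by
  rw [h.trace_eq_overdamped_add hS.isSymm hΓ.isSymm hM.isSymm hb₀ hb₀W]
  have p1 := trace_mul_transpose_mul_mul_nonneg hΓ hS (b - b₀)
  have p2 := trace_mul_transpose_mul_mul_nonneg hΓ hM c
  linarith

/-- For the mass matrix `m I` the excess over the overdamped variance is of order `m`. -/
theorem exists_trace_le_overdamped_add {S Γ W b₀ : Matrix (Fin n) (Fin n) ℝ} (hS : S.PosDef)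
    (hΓ : Γ.PosDef) (hb₀ : (b₀ * Γ).IsSymm) (hb₀W : b₀ᵀ * S + S * b₀ = W) :
    ∃ C : ℝ, ∀ (m : ℝ) (a b c : Matrix (Fin n) (Fin n) ℝ), 0 < m →
      IsLyapunovSolution S Γ (m • (1 : Matrix (Fin n) (Fin n) ℝ)) W a b c →
        (a * W).trace ≤ (b₀ * Γ * W).trace + m * C := by
  have hΓu : IsUnit Γ.det := (isUnit_iff_isUnit_det _).1 hΓ.isUnit
  -- Y represents the functional c ↦ tr(c b₀) on symmetric c in the inner product tr(Γ xᵀ y).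
  set Y := b₀ * Γ⁻¹ with hY
  have hYΓ : Y * Γ = b₀ := by
    rw [hY, Matrix.mul_assoc, nonsing_inv_mul _ hΓu, Matrix.mul_one]
  refine ⟨2 * (Γ * Yᵀ * (1 : Matrix (Fin n) (Fin n) ℝ) * Y).trace, fun m a b c hm h => ?_⟩
  have hM : (m • (1 : Matrix (Fin n) (Fin n) ℝ)).IsSymm := isSymm_one.smul m
  have h1 := h.trace_eq_overdamped_add hS.isSymm hΓ.isSymm hM hb₀ hb₀W
  -- A second expression for the excess, from writing W through b₀ instead of b.
  have h2 : (a * W).trace = (b₀ * Γ * W).trace + 2 * (m * (c * b₀).trace) := by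
    rw [trace_mul_eq_two_mul hS.isSymm h.symm_a hb₀W, h.mul_eq hS.isSymm hΓ.isSymm hM,
      Matrix.add_mul, trace_add, trace_mul_transpose_mul_mul_comm hS.isSymm hΓ.isSymm b b₀,
      trace_overdamped_eq hS.isSymm hΓ.isSymm hb₀ h.eq_qq]
    simp only [Matrix.smul_mul, Matrix.one_mul, trace_smul, smul_eq_mul]
    ring
  have h3 := trace_mul_transpose_mul_mul_nonneg hΓ PosDef.one (c - Y)
  rw [trace_mul_transpose_sub_mul_sub isSymm_one hΓ.isSymm,
    trace_mul_transpose_mul_mul_comm isSymm_one hΓ.isSymm Y c] at h3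
  have h4 : (Γ * cᵀ * (1 : Matrix (Fin n) (Fin n) ℝ) * Y).trace = (c * b₀).trace := by
    rw [h.symm_c.eq, Matrix.mul_one, Matrix.mul_assoc, trace_mul_comm, Matrix.mul_assoc, hYΓ]
  have h5 : (Γ * cᵀ * (m • (1 : Matrix (Fin n) (Fin n) ℝ)) * c).trace =
      m * (Γ * cᵀ * (1 : Matrix (Fin n) (Fin n) ℝ) * c).trace := by
    simp
  have p1 := trace_mul_transpose_mul_mul_nonneg hΓ hS (b - b₀)
  rw [h4] at h3
  rw [h5] at h1
  -- In the norm of tr(Γ xᵀ y), the excess E equals 2m⟨c, Y⟩ and is at least 2m|c|². From |c - Y|² ≥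
  -- 0 follows 2E ≤ 2m|c|² + 2m|Y|² ≤ E + 2m|Y|², hence E ≤ 2m|Y|².
  have h6 := mul_nonneg hm.le h3
  nlinarith

end Lyapunov

/-! ### The generators on quadratic polynomials -/

section Quadratic

variable {n : ℕ}

/-- The quadratic polynomial `q ⬝ a q / 2 + q ⬝ b p + p ⬝ c p / 2 + g ⬝ q + k ⬝ p`. -/
noncomputable def quadPoly (a b c : Matrix (Fin n) (Fin n) ℝ) (g k : Coord n)
    (z : PhaseSpace n) : ℝ :=
  (1 / 2) * (z.1 ⬝ᵥ (a *ᵥ z.1)) + z.1 ⬝ᵥ (b *ᵥ z.2) + (1 / 2) * (z.2 ⬝ᵥ (c *ᵥ z.2)) +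
    g ⬝ᵥ z.1 + k ⬝ᵥ z.2

theorem hasTemperateGrowth_quadPoly (a b c : Matrix (Fin n) (Fin n) ℝ) (g k : Coord n) :
    (quadPoly a b c g k).HasTemperateGrowth := by
  have hq := hasTemperateGrowth_fst (n := n)
  have hp := hasTemperateGrowth_snd (n := n)
  have h1 := hasTemperateGrowth_dotProduct hq (hasTemperateGrowth_mulVec a hq)
  have h2 := hasTemperateGrowth_dotProduct hq (hasTemperateGrowth_mulVec b hp)
  have h3 := hasTemperateGrowth_dotProduct hp (hasTemperateGrowth_mulVec c hp)
  have h4 := hasTemperateGrowth_dotProduct (.const g) hq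
  have h5 := hasTemperateGrowth_dotProduct (.const k) hp
  unfold quadPoly
  fun_prop

theorem derivQ_quadPoly {a : Matrix (Fin n) (Fin n) ℝ} (ha : a.IsSymm)
    (b c : Matrix (Fin n) (Fin n) ℝ) (g k : Coord n) (z : PhaseSpace n) (v : Coord n) :
    derivQ (quadPoly a b c g k) z v = v ⬝ᵥ (a *ᵥ z.1 + b *ᵥ z.2 + g) := by
  refine fderiv_apply_eq_of_quadratic (b := (1 / 2) * (v ⬝ᵥ (a *ᵥ v)))
    ((hasTemperateGrowth_quadPoly a b c g k).1.differentiable (by simp) z) fun t => ?_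
  simp only [quadPoly, Prod.fst_add, Prod.snd_add, Prod.smul_mk, mulVec_add, smul_zero, add_zero,
    mulVec_smul, dotProduct_add, add_dotProduct, smul_dotProduct, dotProduct_smul, smul_eq_mul,
    ha.dotProduct_mulVec_comm z.1 v, dotProduct_comm g v]
  ring

theorem derivP_quadPoly (a b : Matrix (Fin n) (Fin n) ℝ) {c : Matrix (Fin n) (Fin n) ℝ}
    (hc : c.IsSymm) (g k : Coord n) (z : PhaseSpace n) (v : Coord n) :
    derivP (quadPoly a b c g k) z v = v ⬝ᵥ (bᵀ *ᵥ z.1 + c *ᵥ z.2 + k) := by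
  refine fderiv_apply_eq_of_quadratic (b := (1 / 2) * (v ⬝ᵥ (c *ᵥ v)))
    ((hasTemperateGrowth_quadPoly a b c g k).1.differentiable (by simp) z) fun t => ?_
  have hb : z.1 ⬝ᵥ (b *ᵥ v) = v ⬝ᵥ (bᵀ *ᵥ z.1) := by
    rw [dotProduct_mulVec, ← mulVec_transpose, dotProduct_comm]
  simp only [quadPoly, Prod.fst_add, Prod.snd_add, Prod.smul_mk, mulVec_add, smul_zero, add_zero,
    mulVec_smul, dotProduct_add, add_dotProduct, smul_dotProduct, dotProduct_smul, smul_eq_mul,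
    hc.dotProduct_mulVec_comm z.2 v, dotProduct_comm k v, hb]
  ring

theorem diffusionP_quadPoly (Γ a b : Matrix (Fin n) (Fin n) ℝ) {c : Matrix (Fin n) (Fin n) ℝ}
    (hc : c.IsSymm) (g k : Coord n) (z : PhaseSpace n) :
    diffusionP Γ (quadPoly a b c g k) z = (Γ * c).trace := by
  have h (i j : Fin n) : derivP (fun w => derivP (quadPoly a b c g k) w (Pi.single j 1)) z
      (Pi.single i 1) = c j i := by
    refine fderiv_apply_eq_of_quadratic (b := 0)
      (((hasTemperateGrowth_quadPoly a b c g k).derivP _).1.differentiable (by simp) z) fun t => ?_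
    simp only [derivP_quadPoly a b hc, Prod.fst_add, Prod.snd_add, Prod.smul_mk, mulVec_add,
      smul_zero, add_zero, mulVec_smul, dotProduct_add, dotProduct_smul, smul_eq_mul]
    simp
    ring
  simp only [diffusionP, h, trace, diag_apply, Matrix.mul_apply]

theorem dotProduct_mulVec_transpose (A B : Matrix (Fin n) (Fin n) ℝ) (x y : Coord n) :
    (A *ᵥ x) ⬝ᵥ (B *ᵥ y) = x ⬝ᵥ ((Aᵀ * B) *ᵥ y) := by
  rw [← mulVec_mulVec, dotProduct_mulVec x, vecMul_transpose]

/-- The generator maps the quadratic polynomial built from a solution of the Lyapunov equation to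
the observable, up to sign and constants. -/
theorem IsLyapunovSolution.generator_quadPoly {S Γ M U₀ a b c : Matrix (Fin n) (Fin n) ℝ}
    (hS : S.PosDef) (hΓ : Γ.PosDef) (hM : M.PosDef) (l : Coord n)
    (h : IsLyapunovSolution S Γ M (S * U₀ * S) a b c) (z : PhaseSpace n) :
    generator S Γ M (quadPoly a b c (Γ *ᵥ (S *ᵥ l)) (S *ᵥ l)) z =
      (Γ * c).trace - quadObservable U₀ l z.1 := by
  have hSu : IsUnit S.det := (isUnit_iff_isUnit_det _).1 hS.isUnit
  have hMu : IsUnit M.det := (isUnit_iff_isUnit_det _).1 hM.isUnit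
  have hSi := hS.inv.isSymm.eq
  have hMi := hM.inv.isSymm.eq
  -- The block equations, multiplied by inverses on both sides, become the comparison of the qq, qp
  -- and pp coefficients.
  have e1 : S⁻¹ * bᵀ + b * S⁻¹ = U₀ := by
    have := congrArg (fun x => S⁻¹ * x * S⁻¹) h.eq_qq
    simp only [Matrix.mul_add, Matrix.add_mul, Matrix.mul_assoc, mul_nonsing_inv _ hSu,
      Matrix.mul_one] at this
    simpa [← Matrix.mul_assoc, nonsing_inv_mul _ hSu] using this
  have e2 : a * M⁻¹ = b * Γ * M⁻¹ + S⁻¹ * c := by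
    have := congrArg (fun x => S⁻¹ * x * M⁻¹) h.eq_qp
    simp only [Matrix.mul_add, Matrix.add_mul, Matrix.mul_assoc, mul_nonsing_inv _ hMu,
      Matrix.mul_one] at this
    simpa [← Matrix.mul_assoc, nonsing_inv_mul _ hSu] using this
  have e3 : M⁻¹ * b + bᵀ * M⁻¹ = M⁻¹ * Γ * c + c * Γ * M⁻¹ := by
    have := congrArg (fun x => M⁻¹ * x * M⁻¹) h.eq_pp
    simp only [Matrix.mul_add, Matrix.add_mul, Matrix.mul_assoc, mul_nonsing_inv _ hMu,
      Matrix.mul_one] at this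
    simpa [← Matrix.mul_assoc, nonsing_inv_mul _ hMu] using this
  have f1 : z.1 ⬝ᵥ ((S⁻¹ * bᵀ) *ᵥ z.1) = (1 / 2) * (z.1 ⬝ᵥ (U₀ *ᵥ z.1)) := by
    have h1 := dotProduct_transpose_mulVec (S⁻¹ * bᵀ) z.1 z.1
    rw [transpose_mul, transpose_transpose, hSi] at h1
    rw [← e1, add_mulVec, dotProduct_add, h1]
    ring
  have f2 : z.2 ⬝ᵥ ((M⁻¹ * a) *ᵥ z.1) =
      z.2 ⬝ᵥ ((M⁻¹ * Γ * bᵀ) *ᵥ z.1) + z.1 ⬝ᵥ ((S⁻¹ * c) *ᵥ z.2) := by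
    have h1 := dotProduct_transpose_mulVec (a * M⁻¹) z.2 z.1
    have h2 := dotProduct_transpose_mulVec (b * Γ * M⁻¹) z.2 z.1
    rw [transpose_mul, hMi, h.symm_a.eq] at h1
    rw [transpose_mul, transpose_mul, hMi, hΓ.isSymm.eq, ← Matrix.mul_assoc] at h2
    rw [h1, h2, e2, add_mulVec, dotProduct_add]
  have f3 : z.2 ⬝ᵥ ((M⁻¹ * b) *ᵥ z.2) = z.2 ⬝ᵥ ((M⁻¹ * Γ * c) *ᵥ z.2) := by
    have h1 := dotProduct_transpose_mulVec (M⁻¹ * b) z.2 z.2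
    have h2 := dotProduct_transpose_mulVec (M⁻¹ * Γ * c) z.2 z.2
    have h3 := congrArg (fun A => z.2 ⬝ᵥ (A *ᵥ z.2)) e3
    simp only [add_mulVec, dotProduct_add] at h3
    rw [transpose_mul, hMi] at h1
    rw [transpose_mul, transpose_mul, hMi, hΓ.isSymm.eq, h.symm_c.eq, ← Matrix.mul_assoc] at h2
    linarith
  -- The linear part: k = S l turns the force term into l ⬝ q, and g = Γ k cancels the friction
  -- term.
  have f4 : (M⁻¹ *ᵥ z.2) ⬝ᵥ (Γ *ᵥ (S *ᵥ l)) = (Γ *ᵥ (M⁻¹ *ᵥ z.2)) ⬝ᵥ (S *ᵥ l) := by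
    rw [hΓ.isSymm.dotProduct_mulVec_comm, dotProduct_comm]
  have f5 : (S⁻¹ *ᵥ z.1) ⬝ᵥ (S *ᵥ l) = l ⬝ᵥ z.1 := by
    rw [dotProduct_mulVec_transpose, hSi, nonsing_inv_mul _ hSu, one_mulVec, dotProduct_comm]
  have f6 (B : Matrix (Fin n) (Fin n) ℝ) (y : Coord n) : (Γ *ᵥ (M⁻¹ *ᵥ z.2)) ⬝ᵥ (B *ᵥ y) =
      z.2 ⬝ᵥ ((M⁻¹ * Γ * B) *ᵥ y) := by
    rw [mulVec_mulVec, dotProduct_mulVec_transpose, transpose_mul, hMi, hΓ.isSymm.eq]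
  rw [generator, derivQ_quadPoly h.symm_a, derivP_quadPoly a b h.symm_c,
    derivP_quadPoly a b h.symm_c, diffusionP_quadPoly Γ a b h.symm_c, quadObservable]
  simp only [dotProduct_add, f4, f5, f6]
  simp only [dotProduct_mulVec_transpose, hSi, hMi, f1, f2, f3]
  ring

/-- Reversal of momenta exchanges the generator and its adjoint. -/
theorem adjointGenerator_quadPoly_neg (S Γ M : Matrix (Fin n) (Fin n) ℝ)
    {a c : Matrix (Fin n) (Fin n) ℝ} (ha : a.IsSymm) (hc : c.IsSymm)
    (b : Matrix (Fin n) (Fin n) ℝ) (g k : Coord n) (z : PhaseSpace n) :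
    adjointGenerator S Γ M (quadPoly a (-b) c g (-k)) z =
      generator S Γ M (quadPoly a b c g k) (z.1, -z.2) := by
  rw [generator, adjointGenerator, derivQ_quadPoly ha, derivQ_quadPoly ha, derivP_quadPoly a _ hc,
    derivP_quadPoly a _ hc, derivP_quadPoly a _ hc, derivP_quadPoly a _ hc,
    diffusionP_quadPoly Γ a _ hc, diffusionP_quadPoly Γ a _ hc]
  simp only [mulVec_neg, neg_mulVec, transpose_neg, dotProduct_add, dotProduct_neg, neg_dotProduct]
  ring

end Quadratic

/-! ### Gaussian moments by Stein's identity -/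

section Moments

variable {n : ℕ} {S M : Matrix (Fin n) (Fin n) ℝ}

theorem integral_dotProduct_mul (hS : S.PosDef) (hM : M.PosDef) {u : PhaseSpace n → ℝ}
    (hu : u.HasTemperateGrowth) (v : Coord n) :
    ∫ z, (v ⬝ᵥ z.1) * u z ∂(invariantMeasure S M) =
      ∫ z, derivQ u z (S *ᵥ v) ∂(invariantMeasure S M) := by
  have hSu : IsUnit S.det := (isUnit_iff_isUnit_det _).1 hS.isUnit
  unfold derivQ
  rw [integral_fderiv_invariantMeasure hS hM hu]
  refine integral_congr_ae (Eventually.of_forall fun z => ?_)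
  simp only [zero_dotProduct, add_zero]
  rw [dotProduct_mulVec_transpose, hS.isSymm.eq, mul_nonsing_inv _ hSu, one_mulVec, mul_comm]

/-- One integration by parts removes the left factor q; the trace appears when the derivative falls
on A q. -/
theorem integral_dotProduct_mulVec_mul (hS : S.PosDef) (hM : M.PosDef) {u : PhaseSpace n → ℝ}
    (hu : u.HasTemperateGrowth) (A : Matrix (Fin n) (Fin n) ℝ) :
    ∫ z, (z.1 ⬝ᵥ (A *ᵥ z.1)) * u z ∂(invariantMeasure S M) =
      ∫ z, ((S * A).trace * u z + derivQ u z (S *ᵥ (A *ᵥ z.1))) ∂(invariantMeasure S M) := by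
  have hq := hasTemperateGrowth_fst (n := n)
  have hAq := hasTemperateGrowth_mulVec A hq
  have hw (i : Fin n) := hasTemperateGrowth_apply hAq i
  have hd (i : Fin n) (z : PhaseSpace n) (v : Coord n) :
      derivQ (fun z => (A *ᵥ z.1) i) z v = (A *ᵥ v) i :=
    fderiv_apply_eq_of_quadratic (b := 0) ((hw i).1.differentiable (by simp) z) fun t => by
      simp [mulVec_add, mulVec_smul]
  have hterm (i : Fin n) : ∫ z, z.1 i * ((A *ᵥ z.1) i * u z) ∂(invariantMeasure S M) =
      ∫ z, ((A * S) i i * u z + (A *ᵥ z.1) i * derivQ u z (S *ᵥ Pi.single i 1))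
        ∂(invariantMeasure S M) := by
    have := integral_dotProduct_mul hS hM ((hw i).fun_mul hu) (Pi.single i 1)
    simp only [single_one_dotProduct] at this
    rw [this]
    refine integral_congr_ae (Eventually.of_forall fun z => ?_)
    simp only
    have e : ((A * S) *ᵥ Pi.single i 1) i = (A * S) i i := by simp
    rw [derivQ_mul (hw i).1 hu.1, hd, mulVec_mulVec, e]
    ring
  calc _ = ∫ z, ∑ i, z.1 i * ((A *ᵥ z.1) i * u z) ∂(invariantMeasure S M) := by
        simp only [dotProduct, Finset.sum_mul, mul_assoc]
    _ = ∑ i, ∫ z, z.1 i * ((A *ᵥ z.1) i * u z) ∂(invariantMeasure S M) :=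
        integral_finsetSum _ fun i _ => ((hasTemperateGrowth_apply hq i).fun_mul
          ((hw i).fun_mul hu)).integrable_invariantMeasure hS hM
    _ = _ := by
        simp only [hterm]
        rw [← integral_finsetSum _ fun i _ => ((Function.HasTemperateGrowth.fun_mul
          (.const ((A * S) i i)) hu).fun_add ((hw i).fun_mul
          (hu.derivQ _))).integrable_invariantMeasure hS hM]
        refine integral_congr_ae (Eventually.of_forall fun z => ?_)
        simp only [Finset.sum_add_distrib, ← Finset.sum_mul]
        rw [trace_mul_comm]
        congr 1
        have hsum : S *ᵥ (A *ᵥ z.1) = ∑ i, (A *ᵥ z.1) i • (S *ᵥ (Pi.single i 1 : Coord n)) := by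
          conv_lhs => rw [show A *ᵥ z.1 = ∑ i, (A *ᵥ z.1) i • (Pi.single i 1 : Coord n) by
            ext j; simp [Finset.sum_apply, Pi.single_apply]]
          rw [← mulVecLin_apply, map_sum]
          simp
        have h2 : ((S *ᵥ (A *ᵥ z.1), 0) : PhaseSpace n) =
            ∑ i, (A *ᵥ z.1) i • ((S *ᵥ (Pi.single i 1 : Coord n)), (0 : Coord n)) := by
          refine Prod.ext ?_ ?_
          · simpa [Prod.fst_sum] using hsum
          · simp [Prod.snd_sum]
        simp only [derivQ]
        rw [h2, map_sum]
        exact Finset.sum_congr rfl fun i _ => by rw [map_smul, smul_eq_mul]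

theorem integral_dotProduct_mulVec_snd (hS : S.PosDef) (hM : M.PosDef)
    (B : Matrix (Fin n) (Fin n) ℝ) :
    ∫ z, z.1 ⬝ᵥ (B *ᵥ z.2) ∂(invariantMeasure S M) = 0 := by
  have hSu : IsUnit S.det := (isUnit_iff_isUnit_det _).1 hS.isUnit
  -- Integration by parts of constants along the field (S B p, 0), chosen so that the weight
  -- contributes q ⬝ B p.
  have h := integral_mul_derivQ_field hS hM (.const 1) (.const 1)
    (hasTemperateGrowth_mulVec (S * B) (hasTemperateGrowth_snd (n := n)))
  simp only [derivQ, fderiv_fun_const, Pi.zero_apply, _root_.zero_apply, mul_zero,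
    sub_zero, integral_zero, mul_one, one_mul] at h
  rw [h]
  refine integral_congr_ae (Eventually.of_forall fun z => ?_)
  simp only
  rw [dotProduct_mulVec_transpose, transpose_mul, hS.isSymm.eq, Matrix.mul_assoc,
    mul_nonsing_inv _ hSu, Matrix.mul_one, dotProduct_transpose_mulVec]

theorem integral_quadObservable_fst (hS : S.PosDef) (hM : M.PosDef) (U₀ : Matrix (Fin n) (Fin n) ℝ)
    (l : Coord n) : ∫ z, quadObservable U₀ l z.1 ∂(invariantMeasure S M) =
      ∫ x, quadObservable U₀ l x ∂(centredGaussian S) := by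
  have := isProbabilityMeasure_centredGaussian hS
  have := isProbabilityMeasure_centredGaussian hM
  unfold invariantMeasure
  rw [integral_fun_fst]
  simp

theorem hasTemperateGrowth_quadObservable (U₀ : Matrix (Fin n) (Fin n) ℝ) (l : Coord n) :
    (fun z : PhaseSpace n => quadObservable U₀ l z.1).HasTemperateGrowth := by
  have h1 := hasTemperateGrowth_dotProduct hasTemperateGrowth_fst
    (hasTemperateGrowth_mulVec U₀ (hasTemperateGrowth_fst (n := n)))
  have h2 := hasTemperateGrowth_dotProduct (.const l) (hasTemperateGrowth_fst (n := n))
  unfold quadObservable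
  fun_prop

theorem integral_quadObservable_mul (hS : S.PosDef) (hM : M.PosDef)
    (U₀ : Matrix (Fin n) (Fin n) ℝ) (l : Coord n) {u : PhaseSpace n → ℝ}
    (hu : u.HasTemperateGrowth) :
    ∫ z, quadObservable U₀ l z.1 * u z ∂(invariantMeasure S M) =
      (1 / 2) * (S * U₀).trace * ∫ z, u z ∂(invariantMeasure S M) +
      ∫ z, ((1 / 2) * derivQ u z (S *ᵥ (U₀ *ᵥ z.1)) + derivQ u z (S *ᵥ l))
        ∂(invariantMeasure S M) := by
  have hq := hasTemperateGrowth_fst (n := n)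
  have hUq := hasTemperateGrowth_mulVec U₀ hq
  have hint {F : PhaseSpace n → ℝ} (hF : F.HasTemperateGrowth) :=
    hF.integrable_invariantMeasure hS hM
  have i1 := hint (.fun_mul (.const (1 / 2)) ((hasTemperateGrowth_dotProduct hq hUq).fun_mul hu))
  have i2 := hint ((hasTemperateGrowth_dotProduct (.const l) hq).fun_mul hu)
  have i3 := hint (.fun_mul (.const (S * U₀).trace) hu)
  have i4 := hint (hu.derivQ_field (hasTemperateGrowth_mulVec S hUq))
  have i5 := hint (hu.derivQ (S *ᵥ l))
  simp only [quadObservable, add_mul, mul_assoc]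
  rw [integral_add i1 i2, integral_const_mul, integral_dotProduct_mulVec_mul hS hM hu,
    integral_dotProduct_mul hS hM hu, integral_add i3 i4, integral_const_mul,
    integral_add (i4.const_mul _) i5, integral_const_mul]
  ring

theorem integral_quadObservable (hS : S.PosDef) (hM : M.PosDef)
    (U₀ : Matrix (Fin n) (Fin n) ℝ) (l : Coord n) :
    ∫ x, quadObservable U₀ l x ∂(centredGaussian S) = (1 / 2) * (S * U₀).trace := by
  have := isProbabilityMeasure_invariantMeasure hS hM
  have h := integral_quadObservable_mul hS hM U₀ l (.const 1)
  simp only [derivQ, fderiv_fun_const, Pi.zero_apply, _root_.zero_apply, mul_zero, add_zero,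
    integral_zero, mul_one] at h
  rw [← integral_quadObservable_fst hS hM, h]
  simp

theorem integral_dotProduct_fst (hS : S.PosDef) (hM : M.PosDef) (v : Coord n) :
    ∫ z, v ⬝ᵥ z.1 ∂(invariantMeasure S M) = 0 := by
  have h := integral_dotProduct_mul hS hM (.const 1) v
  simpa [derivQ] using h

theorem integral_dotProduct_snd (hS : S.PosDef) (hM : M.PosDef) (v : Coord n) :
    ∫ z, v ⬝ᵥ z.2 ∂(invariantMeasure S M) = 0 := by
  have hMu : IsUnit M.det := (isUnit_iff_isUnit_det _).1 hM.isUnit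
  have h := integral_fderiv_invariantMeasure hS hM (.const 1) (0, M *ᵥ v)
  simp only [dotProduct_mulVec_transpose, hM.isSymm.eq, mul_nonsing_inv _ hMu, one_mulVec] at h
  simpa using h.symm

theorem integral_dotProduct_mulVec_fst (hS : S.PosDef) (hM : M.PosDef)
    (A : Matrix (Fin n) (Fin n) ℝ) :
    ∫ z, z.1 ⬝ᵥ (A *ᵥ z.1) ∂(invariantMeasure S M) = (S * A).trace := by
  have := isProbabilityMeasure_invariantMeasure hS hM
  have h := integral_dotProduct_mulVec_mul hS hM (.const 1) A
  simpa [derivQ] using h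

/-- The covariance of the observable with a quadratic polynomial. -/
theorem integral_centredObservable_mul_quadPoly (hS : S.PosDef) (hM : M.PosDef)
    {U₀ : Matrix (Fin n) (Fin n) ℝ} (hU : U₀.IsSymm) (l : Coord n)
    {a : Matrix (Fin n) (Fin n) ℝ} (ha : a.IsSymm)
    (b c : Matrix (Fin n) (Fin n) ℝ) (g k : Coord n) :
    ∫ z, centredObservable S U₀ l z.1 * quadPoly a b c g k z ∂(invariantMeasure S M) =
      (1 / 2) * (a * (S * U₀ * S)).trace + (S *ᵥ l) ⬝ᵥ g := by
  have := isProbabilityMeasure_invariantMeasure hS hM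
  have hg := hasTemperateGrowth_quadPoly a b c g k
  have hint {F : PhaseSpace n → ℝ} (hF : F.HasTemperateGrowth) :=
    hF.integrable_invariantMeasure hS hM
  have hq := hasTemperateGrowth_fst (n := n)
  have hp := hasTemperateGrowth_snd (n := n)
  have i1 := hint ((hasTemperateGrowth_quadObservable U₀ l).fun_mul hg)
  have i2 := (hint hg).const_mul ((1 / 2) * (S * U₀).trace)
  have j1 := (hint (hasTemperateGrowth_dotProduct hq
    (hasTemperateGrowth_mulVec ((S * U₀)ᵀ * a) hq))).const_mul (1 / 2)
  have j2 := (hint (hasTemperateGrowth_dotProduct hq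
    (hasTemperateGrowth_mulVec ((S * U₀)ᵀ * b) hp))).const_mul (1 / 2)
  have j3 := hint (hasTemperateGrowth_dotProduct
    (.const ((1 / 2 : ℝ) • ((S * U₀)ᵀ *ᵥ g) + aᵀ *ᵥ (S *ᵥ l))) hq)
  have j4 := hint (hasTemperateGrowth_dotProduct (.const (bᵀ *ᵥ (S *ᵥ l))) hp)
  simp only [centredObservable, sub_mul, integral_quadObservable hS hM]
  -- Centring the observable removes exactly the trace term of the integration by parts; only the
  -- derivatives of the polynomial remain.
  rw [integral_sub i1 i2, integral_quadObservable_mul hS hM U₀ l hg, integral_const_mul,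
    add_sub_cancel_left]
  calc _ = ∫ z : PhaseSpace n, ((1 / 2) * (z.1 ⬝ᵥ (((S * U₀)ᵀ * a) *ᵥ z.1)) +
        (1 / 2) * (z.1 ⬝ᵥ (((S * U₀)ᵀ * b) *ᵥ z.2)) +
        ((1 / 2 : ℝ) • ((S * U₀)ᵀ *ᵥ g) + aᵀ *ᵥ (S *ᵥ l)) ⬝ᵥ z.1 +
        (bᵀ *ᵥ (S *ᵥ l)) ⬝ᵥ z.2 + (S *ᵥ l) ⬝ᵥ g) ∂(invariantMeasure S M) := by
        refine integral_congr_ae (Eventually.of_forall fun z => ?_)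
        simp only [derivQ_quadPoly ha, dotProduct_add, add_dotProduct, smul_dotProduct,
          smul_eq_mul]
        rw [mulVec_mulVec (v := z.1), dotProduct_mulVec_transpose, dotProduct_mulVec_transpose,
          dotProduct_comm _ z.1, dotProduct_transpose_mulVec, dotProduct_comm (aᵀ *ᵥ _),
          dotProduct_transpose_mulVec, dotProduct_comm (bᵀ *ᵥ _), dotProduct_transpose_mulVec,
          dotProduct_comm g]
        ring
    _ = (1 / 2) * (S * ((S * U₀)ᵀ * a)).trace + (S *ᵥ l) ⬝ᵥ g := by
        rw [integral_add (((j1.fun_add j2).fun_add j3).fun_add j4) (integrable_const _),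
          integral_add ((j1.fun_add j2).fun_add j3) j4, integral_add (j1.fun_add j2) j3,
          integral_add j1 j2, integral_const_mul, integral_const_mul,
          integral_dotProduct_mulVec_fst hS hM, integral_dotProduct_mulVec_snd hS hM,
          integral_dotProduct_fst hS hM, integral_dotProduct_snd hS hM]
        simp
    _ = _ := by
        rw [transpose_mul, hU.eq, hS.isSymm.eq, ← Matrix.mul_assoc, ← Matrix.mul_assoc,
          trace_mul_comm]

end Moments

/-! ### Existence of solutions and the variance of an arbitrary weak solution -/

section Poisson

variable {n : ℕ} {S Γ M U₀ a b c : Matrix (Fin n) (Fin n) ℝ}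

/-- The adjoint generator annihilates constants, so the generator of the polynomial has mean zero;
this fixes the constant term. -/
theorem IsLyapunovSolution.trace_mul_eq_integral (hS : S.PosDef) (hΓ : Γ.PosDef) (hM : M.PosDef)
    (h : IsLyapunovSolution S Γ M (S * U₀ * S) a b c) (l : Coord n) :
    (Γ * c).trace = ∫ x, quadObservable U₀ l x ∂(centredGaussian S) := by
  have := isProbabilityMeasure_invariantMeasure hS hM
  have h1 := integral_mul_adjointGenerator hS hΓ.isSymm hM
    (hasTemperateGrowth_quadPoly a b c (Γ *ᵥ (S *ᵥ l)) (S *ᵥ l)) (.const 1)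
  have h2 (z : PhaseSpace n) : adjointGenerator S Γ M (fun _ => (1 : ℝ)) z = 0 := by
    simp [adjointGenerator, derivQ, derivP, diffusionP]
  simp only [h2, h.generator_quadPoly hS hΓ hM, mul_zero, integral_zero, mul_one] at h1
  rw [integral_sub (integrable_const _)
    ((hasTemperateGrowth_quadObservable U₀ l).integrable_invariantMeasure hS hM),
    integral_quadObservable_fst hS hM] at h1
  simp only [integral_const, probReal_univ, one_smul] at h1
  linarith

theorem generator_sub_const (S Γ M : Matrix (Fin n) (Fin n) ℝ) (φ : PhaseSpace n → ℝ) (κ : ℝ)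
    (z : PhaseSpace n) : generator S Γ M (fun z => φ z - κ) z = generator S Γ M φ z := by
  simp only [generator, diffusionP, derivQ, derivP, fderiv_sub_const]

/-- A function of temperate growth that solves the Poisson equation pointwise is a weak
solution. -/
theorem isPoissonSolution_of_generator_eq (hS : S.PosDef) (hΓ : Γ.PosDef) (hM : M.PosDef)
    {l : Coord n} {φ : PhaseSpace n → ℝ} (hφ : φ.HasTemperateGrowth)
    (h0 : ∫ z, φ z ∂(invariantMeasure S M) = 0)
    (h : ∀ z, -generator S Γ M φ z = centredObservable S U₀ l z.1) :
    IsPoissonSolution S Γ M U₀ l φ where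
  memLp := hφ.memLp_two_invariantMeasure hS hM
  mean_zero := h0
  weak_eq u hu hc := by
    rw [integral_mul_adjointGenerator hS hΓ.isSymm hM hφ (hc.hasTemperateGrowth hu),
      ← integral_neg]
    simp only [← neg_mul, h]

theorem exists_isPoissonSolution (hS : S.PosDef) (hU : U₀.PosDef) (hΓ : Γ.PosDef) (hM : M.PosDef)
    (l : Coord n) : ∃ φ : PhaseSpace n → ℝ, IsPoissonSolution S Γ M U₀ l φ ∧ ContDiff ℝ ∞ φ ∧
      ∀ z, -generator S Γ M φ z = centredObservable S U₀ l z.1 := by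
  have := isProbabilityMeasure_invariantMeasure hS hM
  have hW : (S * U₀ * S).IsSymm := by
    simp [Matrix.IsSymm, transpose_mul, hS.isSymm.eq, hU.isSymm.eq, Matrix.mul_assoc]
  obtain ⟨a, b, c, h⟩ := exists_isLyapunovSolution hS hΓ hM hW
  have hg := hasTemperateGrowth_quadPoly a b c (Γ *ᵥ (S *ᵥ l)) (S *ᵥ l)
  set κ := ∫ z, quadPoly a b c (Γ *ᵥ (S *ᵥ l)) (S *ᵥ l) z ∂(invariantMeasure S M) with hκ
  have hφ : (fun z => quadPoly a b c (Γ *ᵥ (S *ᵥ l)) (S *ᵥ l) z - κ).HasTemperateGrowth :=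
    hg.fun_sub (.const κ)
  have heq : ∀ z, -generator S Γ M (fun z => quadPoly a b c (Γ *ᵥ (S *ᵥ l)) (S *ᵥ l) z - κ) z =
      centredObservable S U₀ l z.1 := by
    intro z
    rw [generator_sub_const, h.generator_quadPoly hS hΓ hM,
      h.trace_mul_eq_integral hS hΓ hM l, centredObservable]
    ring
  refine ⟨_, isPoissonSolution_of_generator_eq hS hΓ hM hφ ?_ heq, hφ.1, heq⟩
  rw [integral_sub (hg.integrable_invariantMeasure hS hM) (integrable_const _),
    ← hκ, integral_const, probReal_univ, one_smul, sub_self]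

/-- The asymptotic variance (halved) of every weak solution. -/
theorem IsPoissonSolution.integral_mul_centredObservable (hS : S.PosDef) (hU : U₀.PosDef)
    (hΓ : Γ.PosDef) (hM : M.PosDef) {l : Coord n} {φ : PhaseSpace n → ℝ}
    (hφ : IsPoissonSolution S Γ M U₀ l φ)
    (h : IsLyapunovSolution S Γ M (S * U₀ * S) a b c) :
    ∫ z, φ z * centredObservable S U₀ l z.1 ∂(invariantMeasure S M) =
      (1 / 2) * (a * (S * U₀ * S)).trace + (S *ᵥ l) ⬝ᵥ (Γ *ᵥ (S *ᵥ l)) := by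
  have hg := hasTemperateGrowth_quadPoly a (-b) c (Γ *ᵥ (S *ᵥ l)) (-(S *ᵥ l))
  -- The observable does not depend on p, so the momentum-reversed polynomial ψ satisfies -𝓛*ψ = f -
  -- π(f). Testing with ψ then replaces φ by ψ in the integral against f - π(f).
  have hL (z : PhaseSpace n) : adjointGenerator S Γ M
      (quadPoly a (-b) c (Γ *ᵥ (S *ᵥ l)) (-(S *ᵥ l))) z = -centredObservable S U₀ l z.1 := by
    rw [adjointGenerator_quadPoly_neg S Γ M h.symm_a h.symm_c, h.generator_quadPoly hS hΓ hM,
      h.trace_mul_eq_integral hS hΓ hM l, centredObservable]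
    ring
  have h1 := hφ.weak_eq_of_hasTemperateGrowth hS hΓ.isSymm hM hg
  simp only [hL, mul_neg, integral_neg, neg_neg] at h1
  rw [h1, integral_centredObservable_mul_quadPoly hS hM hU.isSymm l h.symm_a]

end Poisson

/-! ### The main theorem -/

theorem mainTheorem11 (n : ℕ) (S U₀ Γ : Matrix (Fin n) (Fin n) ℝ) (l : Coord n)
    (hS : S.PosDef) (hU : U₀.PosDef) (hΓ : Γ.PosDef) (hcomm : S * U₀ = U₀ * S) :
    -- for every mass matrix the Poisson equation has a solution, and even a classical one
    (∀ M : Matrix (Fin n) (Fin n) ℝ, M.PosDef →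
      ∃ φ : PhaseSpace n → ℝ, IsPoissonSolution S Γ M U₀ l φ ∧ ContDiff ℝ ∞ φ ∧
        ∀ z, -generator S Γ M φ z = centredObservable S U₀ l z.1) ∧
    -- the limit along `M = m I`, `m → 0⁺`, exists and is the infimum over all mass matrices
    (∀ φ : Matrix (Fin n) (Fin n) ℝ → PhaseSpace n → ℝ,
      (∀ M : Matrix (Fin n) (Fin n) ℝ, M.PosDef → IsPoissonSolution S Γ M U₀ l (φ M)) →
      ∃ c : ℝ,
        Tendsto
          (fun m : ℝ => ∫ z, φ (m • (1 : Matrix (Fin n) (Fin n) ℝ)) z * centredObservable S U₀ l z.1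
            ∂(invariantMeasure S (m • (1 : Matrix (Fin n) (Fin n) ℝ))))
          (𝓝[>] 0) (𝓝 c) ∧
        IsGLB
          ((fun M : Matrix (Fin n) (Fin n) ℝ =>
            ∫ z, φ M z * centredObservable S U₀ l z.1 ∂(invariantMeasure S M)) ''
              {M : Matrix (Fin n) (Fin n) ℝ | M.PosDef}) c) := by
  refine ⟨fun M hM => exists_isPoissonSolution hS hU hΓ hM l, fun φ hφ => ?_⟩
  have hW : (S * U₀ * S).IsSymm := by
    simp [Matrix.IsSymm, transpose_mul, hS.isSymm.eq, hU.isSymm.eq, Matrix.mul_assoc]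
  obtain ⟨b₀, hb₀, hb₀W⟩ := exists_overdamped_solution hS hΓ hW
  obtain ⟨C, hC⟩ := exists_trace_le_overdamped_add hS hΓ hb₀ hb₀W
  set v : Matrix (Fin n) (Fin n) ℝ → ℝ := fun M =>
    ∫ z, φ M z * centredObservable S U₀ l z.1 ∂(invariantMeasure S M) with hv
  -- The overdamped value: the variance formula with b₀ Γ in place of a.
  set c₀ : ℝ := (1 / 2) * (b₀ * Γ * (S * U₀ * S)).trace + (S *ᵥ l) ⬝ᵥ (Γ *ᵥ (S *ᵥ l)) with hc₀
  have hlow (M : Matrix (Fin n) (Fin n) ℝ) (hM : M.PosDef) : c₀ ≤ v M := by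
    obtain ⟨a, b, c, h⟩ := exists_isLyapunovSolution hS hΓ hM hW
    have h1 := h.overdamped_le hS hΓ hM hb₀ hb₀W
    have h2 : v M = _ := (hφ M hM).integral_mul_centredObservable hS hU hΓ hM h
    rw [h2, hc₀]
    linarith
  have hmI (m : ℝ) (hm : 0 < m) : (m • (1 : Matrix (Fin n) (Fin n) ℝ)).PosDef :=
    PosDef.one.smul hm
  have hup (m : ℝ) (hm : 0 < m) : v (m • (1 : Matrix (Fin n) (Fin n) ℝ)) ≤ c₀ + m * (C / 2) := by
    obtain ⟨a, b, c, h⟩ := exists_isLyapunovSolution hS hΓ (hmI m hm) hW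
    have h1 := hC m a b c hm h
    have h2 : v (m • (1 : Matrix (Fin n) (Fin n) ℝ)) = _ :=
      (hφ _ (hmI m hm)).integral_mul_centredObservable hS hU hΓ (hmI m hm) h
    rw [h2, hc₀]
    linarith
  have hlim : Tendsto (fun m : ℝ => v (m • (1 : Matrix (Fin n) (Fin n) ℝ))) (𝓝[>] 0) (𝓝 c₀) := by
    refine tendsto_of_tendsto_of_tendsto_of_le_of_le' (h := fun m : ℝ => c₀ + m * (C / 2))
      tendsto_const_nhds ?_ ?_ ?_
    · have : Tendsto (fun m : ℝ => c₀ + m * (C / 2)) (𝓝 0) (𝓝 (c₀ + 0 * (C / 2))) :=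
        (by fun_prop : Continuous fun m : ℝ => c₀ + m * (C / 2)).tendsto 0
      rw [zero_mul, add_zero] at this
      exact this.mono_left nhdsWithin_le_nhds
    · filter_upwards [self_mem_nhdsWithin] with m hm using hlow _ (hmI m hm)
    · filter_upwards [self_mem_nhdsWithin] with m hm using hup m hm
  refine ⟨c₀, hlim, ?_, fun w hw => ?_⟩
  · rintro _ ⟨M, hM, rfl⟩
    exact hlow M hM
  -- A lower bound over all M holds along M = mI and therefore passes to the limit.
  · refine ge_of_tendsto hlim ?_
    filter_upwards [self_mem_nhdsWithin] with m hm using hw ⟨_, hmI m hm, rfl⟩
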